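/- All alphabets are finite; for $j\in\{1,2\}$ let $j'$ denote the other index. \textbf{Setting.} Let $(S_{1,k},S_{2,k})$, $k\ge 1$, be i.i.d. with distribution $P_{S_1,S_2}$ on $\mathcal S_1\times\mathcal S_2$, let $P_{Y_1,Y_2|X_1,X_2}$ be the transition probability of a discrete memoryless two-way channel with inputs $\mathcal X_1,\mathcal X_2$ and outputs $\mathcal Y_1,\mathcal Y_2$, and let $d_j:\mathcal S_j\times\hat{\mathcal S}_j\to\mathbb R_{\ge 0}$. An $(N,K)$ code consists of encoders $X_{j,n}=f_{j,n}(S_j^K,Y_j^{n-1})$, $1\le n\le N$, and decoders $\hat S_j^K=g_{j'}(S_{j'}^K,Y_{j'}^N)$, $j=1,2$; its distortions are $D_j(K)=\mathbb E\big[\frac1K\sum_{k=1}^K d_j(S_{j,k},\hat S_{j,k})\big]$. A pair $(D_1,D_2)$ is achievable at rate $R$ if there are $(N,K)$ codes, $N=N(K)$, with $\lim_{K\to\infty}K/N=R$ and $\limsup_{K\to\infty}D_j(K)\le D_j$ for $j=1,2$. \textbf{Wyner--Ziv function.} $R^{(j)}_{\rm WZ}(D_j)=\min I(S_j;T_j|S_{j'})$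 over all $P_{T_j|S_j}$ with $|\mathcal T_j|\le|\mathcal S_j|+1$ and $T_j - S_j - S_{j'}$ a Markov chain, and all $h:\mathcal T_j\times\mathcal S_{j'}\to\hat{\mathcal S}_j$ with $\mathbb E[d_j(S_j,h(T_j,S_{j'}))]\le D_j$. \textbf{Configurations.} Put $\tilde{\mathcal S}_j=\mathcal S_j$, $\tilde{\mathcal U}_j=\mathcal U_j$, $\tilde{\mathcal W}_j=\mathcal X_j\times\mathcal Y_j$. A configuration is a tuple $(P_{U_1|S_1},P_{U_2|S_2},P_{\tilde S_1,\tilde S_2,\tilde U_1,\tilde U_2},P_{\tilde W_1,\tilde W_2|\tilde S_1,\tilde S_2,\tilde U_1,\tilde U_2},F_1,F_2,G_1,G_2)$ with functions $F_j:\mathcal S_j\times\mathcal U_j\times\tilde{\mathcal S}_j\times\tilde{\mathcal U}_j\times\tilde{\mathcal W}_j\to\mathcal X_j$ and $G_j:\tilde{\mathcal U}_{j'}\times\mathcal S_j\times\mathcal U_j\times\tilde{\mathcal S}_j\times\tilde{\mathcal U}_j\times\tilde{\mathcal W}_j\times\mathcal Y_j\to\hat{\mathcal S}_{j'}$. It defines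 the distribution $P_Z$ of $Z=(S_j,U_j,\tilde S_j,\tilde U_j,\tilde W_j,X_j,Y_j)_{j=1,2}$ in which $(S_1,S_2,U_1,U_2)\sim P_{S_1,S_2}P_{U_1|S_1}P_{U_2|S_2}$ is independent of $(\tilde S_1,\tilde S_2,\tilde U_1,\tilde U_2,\tilde W_1,\tilde W_2)$, the latter has the given distribution, $X_j=F_j(S_j,U_j,\tilde S_j,\tilde U_j,\tilde W_j)$, and $(Y_1,Y_2)$ is the channel output for input $(X_1,X_2)$. It also defines the Markov chain with initial law $P_Z$ whose transition sets the new $(\tilde S_j,\tilde U_j,\tilde W_j)$ to the previous $(S_j,U_j,(X_j,Y_j))$, draws new $(S_1,S_2,U_1,U_2)$ independently of the past from $P_{S_1,S_2}P_{U_1|S_1}P_{U_2|S_2}$, and then forms $X_j$ by $F_j$ and $(Y_1,Y_2)$ by the channel. $\Pi_Z(D_1,D_2)$ is the set of configurations for which this chain is stationary and $\mathbb E\big[d_j\big(\tilde S_j,G_{j'}(\tilde U_j,S_{j'},U_{j'},\tilde S_{j'},\tilde U_{j'},\tilde W_{j'},Y_{j'})\big)\big]\le D_j$ for $j=1,2$.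 $\Pi''_Z(D_1,D_2)\subseteq\Pi_Z(D_1,D_2)$ is the subset of configurations with $U_j=(V_j,T_j)$, $\tilde U_j=(\tilde V_j,\tilde T_j)$ such that, for some $P_{V_j}$, $P_{T_j|S_j}$ with $|\mathcal T_j|\le|\mathcal S_j|+1$, $P_{\tilde W_1,\tilde W_2|\tilde V_1,\tilde V_2}$, $\gamma_j$ and $h_j$: $P_{U_j|S_j}=P_{V_j}P_{T_j|S_j}$; $P_{\tilde S_1,\tilde S_2,\tilde U_1,\tilde U_2}=P_{S_1,S_2}\prod_{j}P_{V_j}P_{T_j|S_j}$ (evaluated at the tilde variables); $P_{\tilde W_1,\tilde W_2|\tilde S_1,\tilde S_2,\tilde U_1,\tilde U_2}=P_{\tilde W_1,\tilde W_2|\tilde V_1,\tilde V_2}$; $F_j=\gamma_j(V_j,\tilde V_j,\tilde W_j)$; $G_j=h_j(\tilde T_{j'},\tilde S_j)$; and $(P_{T_j|S_j},h_{j'})$ attains the minimum defining $R^{(j)}_{\rm WZ}(D_j)$, $j=1,2$. \textbf{Corollary.} $(D_1,D_2)$ is achievable at rate $1$ if some configuration in $\Pi''_Z(D_1,D_2)$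 satisfies $$R^{(1)}_{\rm WZ}(D_1)<I(\tilde V_1;X_2,Y_2,\tilde V_2,\tilde W_2),\qquad R^{(2)}_{\rm WZ}(D_2)<I(\tilde V_2;X_1,Y_1,\tilde V_1,\tilde W_1),$$ where the mutual informations (Han's adaptive channel-coding rates) are computed under the stationary distribution $P_Z$ of the configuration. -/

import Mathlib

open Filter Topology

noncomputable section

namespace TwoWay

/-! ### Finite-alphabet information measures

A probability mass function on a finite type `Ω` is a point of `stdSimplex ℝ Ω`; a random variable is a
function on `Ω`. Logarithms are natural: the base only rescales all information quantities by the same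
positive factor. -/

section Information

variable {Ω α β γ : Type*} [Fintype Ω] [Fintype α] [Fintype β] [Fintype γ]

open Classical in
/-- The probability mass function of the random variable `A` under the mass function `p`. -/
def law (p : Ω → ℝ) (A : Ω → α) (a : α) : ℝ := ∑ ω, if A ω = a then p ω else 0

/-- Shannon entropy `H(A)` (with `0 log 0 = 0`). -/
def entropy (p : Ω → ℝ) (A : Ω → α) : ℝ := ∑ a, Real.negMulLog (law p A a)

/-- Mutual information `I(A; B) = H(A) + H(B) - H(A, B)`. -/
def mutualInfo (p : Ω → ℝ) (A : Ω → α) (B : Ω → β) : ℝ :=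
  entropy p A + entropy p B - entropy p (fun ω => (A ω, B ω))

/-- Conditional mutual information
`I(A; B | C) = H(A, C) + H(B, C) - H(A, B, C) - H(C)`. -/
def condMutualInfo (p : Ω → ℝ) (A : Ω → α) (B : Ω → β) (C : Ω → γ) : ℝ :=
  entropy p (fun ω => (A ω, C ω)) + entropy p (fun ω => (B ω, C ω))
    - entropy p (fun ω => (A ω, B ω, C ω)) - entropy p C

/-- Expectation of `f` under the mass function `p`. -/
def expect (p : Ω → ℝ) (f : Ω → ℝ) : ℝ := ∑ ω, p ω * f ω

end Information

/-! ### The two-way system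

The two terminals are indexed by `Bool` (terminal 1 is `false`, terminal 2 is `true`); the terminal other
than `j` is `!j`. Objects that reconstruct the source of terminal `j` (at terminal `!j`) carry the index `j`
of that source. -/

/-- The data of the problem: the joint distribution of the correlated source pair, the transition
probability of the discrete memoryless two-way channel, and the two single-letter distortion measures. -/
structure System (S Shat X Y : Bool → Type*)
    [∀ j, Fintype (S j)] [∀ j, Fintype (Shat j)] [∀ j, Fintype (X j)] [∀ j, Fintype (Y j)] where
  /-- `P_{S₁, S₂}` -/
  src : (∀ j, S j) → ℝ
  src_mem : src ∈ stdSimplex ℝ (∀ j, S j)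
  /-- `P_{Y₁, Y₂ | X₁, X₂}` -/
  chan : (∀ j, X j) → (∀ j, Y j) → ℝ
  chan_mem : ∀ x, chan x ∈ stdSimplex ℝ (∀ j, Y j)
  /-- `d_j` -/
  dist : ∀ j, S j → Shat j → ℝ
  dist_nonneg : ∀ j s t, 0 ≤ dist j s t

/-- An `(N, K)` joint source-channel code: at time `n` the encoder of terminal `j` sees its whole source block
and its channel outputs strictly before time `n`; `dec j` is used by terminal `!j`, which sees its own source
block and all of its channel outputs, to reconstruct the source block of terminal `j`. -/
structure Code (S Shat X Y : Bool → Type*) (N K : ℕ) where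
  enc : ∀ j, (n : Fin N) → (Fin K → S j) → (Fin (n : ℕ) → Y j) → X j
  dec : ∀ j, (Fin K → S (!j)) → (Fin N → Y (!j)) → (Fin K → Shat j)

namespace Code

variable {S Shat X Y : Bool → Type*}
  [∀ j, Fintype (S j)] [∀ j, Fintype (Shat j)] [∀ j, Fintype (X j)] [∀ j, Fintype (Y j)] {N K : ℕ}

/-- The channel input of terminal `j` at time `n` for source blocks `s` and channel outputs `y`. -/
def input (c : Code S Shat X Y N K) (s : ∀ j, Fin K → S j) (y : ∀ j, Fin N → Y j)
    (n : Fin N) (j : Bool) : X j :=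
  c.enc j n (s j) (fun i => y j (Fin.castLE n.isLt.le i))

/-- The joint distribution of the source blocks and the channel outputs; the channel inputs are the
functions `input` of these. -/
def jointLaw (sys : System S Shat X Y) (c : Code S Shat X Y N K)
    (s : ∀ j, Fin K → S j) (y : ∀ j, Fin N → Y j) : ℝ :=
  (∏ k, sys.src (fun j => s j k)) * ∏ n, sys.chan (c.input s y n) (fun j => y j n)

/-- The expected distortion `D_j(K)` of the reconstruction of the source block of terminal `j`. -/
def distortion (sys : System S Shat X Y) (c : Code S Shat X Y N K) (j : Bool) : ℝ :=
  ∑ s : (∀ j, Fin K → S j), ∑ y : (∀ j, Fin N → Y j),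
    c.jointLaw sys s y *
      ((K : ℝ)⁻¹ * ∑ k, sys.dist j (s j k) (c.dec j (s (!j)) (y (!j)) k))

end Code

/-- The state of the Markov chain of the two-way coded channel:
`(S, U, S̃, Ũ, W̃, X, Y)` at both terminals, where `W̃_j` ranges over `X_j × Y_j`. -/
structure State (S X Y U : Bool → Type*) where
  s : ∀ j, S j
  u : ∀ j, U j
  sT : ∀ j, S j
  uT : ∀ j, U j
  wT : ∀ j, X j × Y j
  x : ∀ j, X j
  y : ∀ j, Y j

/-- A state is the tuple of its components. -/
def State.equivProd (S X Y U : Bool → Type*) :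
    ((∀ j, S j) × (∀ j, U j) × (∀ j, S j) × (∀ j, U j) × (∀ j, X j × Y j) × (∀ j, X j) × (∀ j, Y j))
      ≃ State S X Y U where
  toFun t := ⟨t.1, t.2.1, t.2.2.1, t.2.2.2.1, t.2.2.2.2.1, t.2.2.2.2.2.1, t.2.2.2.2.2.2⟩
  invFun z := (z.s, z.u, z.sT, z.uT, z.wT, z.x, z.y)
  left_inv _ := rfl
  right_inv _ := rfl

instance State.instFintype (S X Y U : Bool → Type*) [∀ j, Fintype (S j)] [∀ j, Fintype (X j)]
    [∀ j, Fintype (Y j)] [∀ j, Fintype (U j)] : Fintype (State S X Y U) :=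
  Fintype.ofEquiv _ (State.equivProd S X Y U)

/-- A configuration
`(P_{U₁|S₁}, P_{U₂|S₂}, P_{S̃₁,S̃₂,Ũ₁,Ũ₂}, P_{W̃₁,W̃₂|S̃₁,S̃₂,Ũ₁,Ũ₂}, F₁, F₂, G₁, G₂)`.
The arguments of `F j` are `s_j, u_j, s̃_j, ũ_j, w̃_j`; those of `G j`, with `i = !j` the reconstructing
terminal, are `ũ_j, s_i, u_i, s̃_i, ũ_i, w̃_i, y_i`. -/
structure Configuration (S Shat X Y U : Bool → Type*)
    [∀ j, Fintype (S j)] [∀ j, Fintype (X j)] [∀ j, Fintype (Y j)] [∀ j, Fintype (U j)] where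
  PU : ∀ j, S j → U j → ℝ
  PU_mem : ∀ j s, PU j s ∈ stdSimplex ℝ (U j)
  PT : (∀ j, S j) × (∀ j, U j) → ℝ
  PT_mem : PT ∈ stdSimplex ℝ ((∀ j, S j) × (∀ j, U j))
  PW : (∀ j, S j) → (∀ j, U j) → (∀ j, X j × Y j) → ℝ
  PW_mem : ∀ s u, PW s u ∈ stdSimplex ℝ (∀ j, X j × Y j)
  F : ∀ j, S j → U j → S j → U j → X j × Y j → X j
  G : ∀ j, U j → S (!j) → U (!j) → S (!j) → U (!j) → X (!j) × Y (!j) → Y (!j) → Shat j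

namespace Configuration

variable {S Shat X Y U : Bool → Type*}
  [∀ j, Fintype (S j)] [∀ j, Fintype (Shat j)] [∀ j, Fintype (X j)] [∀ j, Fintype (Y j)] [∀ j, Fintype (U j)]

/-- The probability that the current source pair is `z.s`, its coded versions are `z.u`, and the channel
inputs and outputs are `z.x` and `z.y`, given the prior information `z.sT, z.uT, z.wT`. -/
def innovation (sys : System S Shat X Y) (c : Configuration S Shat X Y U) (z : State S X Y U) : ℝ :=
  open Classical in
  sys.src z.s * (∏ j, c.PU j (z.s j) (z.u j))
    * (∏ j, if z.x j = c.F j (z.s j) (z.u j) (z.sT j) (z.uT j) (z.wT j) then 1 else 0)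
    * sys.chan z.x z.y

/-- The transition probability `Q_Z` from the state `z'` to the state `z`. -/
def kernel (sys : System S Shat X Y) (c : Configuration S Shat X Y U) (z' z : State S X Y U) : ℝ :=
  open Classical in
  (∏ j, (if z.sT j = z'.s j then 1 else 0) * (if z.uT j = z'.u j then 1 else 0)
      * (if z.wT j = (z'.x j, z'.y j) then 1 else 0))
    * c.innovation sys z

/-- The distribution `P_Z` of the state at time 1 specified by the configuration. -/
def PZ (sys : System S Shat X Y) (c : Configuration S Shat X Y U) (z : State S X Y U) : ℝ :=
  c.PT (z.sT, z.uT) * c.PW z.sT z.uT z.wT * c.innovation sys z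

/-- The chain started from `P_Z` is stationary: `P_Z = P_Z Q_Z`. -/
def IsStationary (sys : System S Shat X Y) (c : Configuration S Shat X Y U) : Prop :=
  ∀ z, ∑ z', c.PZ sys z' * c.kernel sys z' z = c.PZ sys z

/-- The expected distortion between `S̃_j` and its reconstruction by `G j`. -/
def distortion (sys : System S Shat X Y) (c : Configuration S Shat X Y U) (j : Bool) : ℝ :=
  expect (c.PZ sys) fun z =>
    sys.dist j (z.sT j) (c.G j (z.uT j) (z.s (!j)) (z.u (!j)) (z.sT (!j)) (z.uT (!j)) (z.wT (!j)) (z.y (!j)))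

end Configuration

namespace System

variable {S Shat X Y : Bool → Type*}
  [∀ j, Fintype (S j)] [∀ j, Fintype (Shat j)] [∀ j, Fintype (X j)] [∀ j, Fintype (Y j)]

/-- The distortion pair `D` is achievable at rate `R` (source symbols per channel use). The upper limit is that
of a bounded sequence, the alphabets being finite. -/
def Achievable (sys : System S Shat X Y) (R : ℝ) (D : Bool → ℝ) : Prop :=
  ∃ (N : ℕ → ℕ) (c : ∀ K, Code S Shat X Y (N K) K),
    (∀ K, 0 < N K) ∧
    Tendsto (fun K : ℕ => (K : ℝ) / (N K : ℝ)) atTop (𝓝 R) ∧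
    ∀ j, limsup (fun K => (c K).distortion sys j) atTop ≤ D j

section WynerZiv

variable {T : Type*} [Fintype T]

/-- The joint distribution of `(S₁, S₂, T_j)` under the Markov chain `T_j - S_j - S_{j'}`, where `p` is
`P_{T_j|S_j}`. -/
def wzLaw (sys : System S Shat X Y) (j : Bool) (p : S j → T → ℝ) (ω : (∀ i, S i) × T) : ℝ :=
  sys.src ω.1 * p (ω.1 j) ω.2

/-- `E[d_j(S_j, h(T_j, S_{j'}))]` -/
def wzDistortion (sys : System S Shat X Y) (j : Bool) (p : S j → T → ℝ) (h : T → S (!j) → Shat j) : ℝ :=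
  expect (sys.wzLaw j p) fun ω => sys.dist j (ω.1 j) (h ω.2 (ω.1 (!j)))

/-- `I(S_j; T_j | S_{j'})` -/
def wzInfo (sys : System S Shat X Y) (j : Bool) (p : S j → T → ℝ) : ℝ :=
  condMutualInfo (sys.wzLaw j p) (fun ω => ω.1 j) (fun ω => ω.2) (fun ω => ω.1 (!j))

end WynerZiv

/-- The Wyner-Ziv rate-distortion function `R_WZ^{(j)}(D)` of the source of terminal `j` with side information at
terminal `!j`. An auxiliary alphabet with at most `|S_j| + 1` letters is contained in one with exactly
`|S_j| + 1` letters. The value is `⊤` if no auxiliary variable meets the distortion constraint. -/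
def wzRate (sys : System S Shat X Y) (j : Bool) (D : ℝ) : EReal :=
  sInf {r : EReal | ∃ (p : S j → Fin (Fintype.card (S j) + 1) → ℝ)
      (h : Fin (Fintype.card (S j) + 1) → S (!j) → Shat j),
    (∀ s, p s ∈ stdSimplex ℝ (Fin (Fintype.card (S j) + 1))) ∧
    sys.wzDistortion j p h ≤ D ∧ r = (sys.wzInfo j p : EReal)}

/-- `Π_Z(D₁, D₂)`: the configurations that induce a stationary chain and satisfy the distortion
constraints. -/
def configurations {U : Bool → Type*} [∀ j, Fintype (U j)] (sys : System S Shat X Y) (D : Bool → ℝ) :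
    Set (Configuration S Shat X Y U) :=
  {c | c.IsStationary sys ∧ ∀ j, c.distortion sys j ≤ D j}

variable {V T : Bool → Type*} [∀ j, Fintype (V j)] [∀ j, Fintype (T j)]

/-- `Π''_Z(D₁, D₂)`: the configurations in `Π_Z(D₁, D₂)` with `U_j = (V_j, T_j)` in which `(V_j)`, with
`P_{W̃₁,W̃₂|Ṽ₁,Ṽ₂}` (here `q`) and the encoders `γ_j`, are as in Han's adaptive channel coding, and `P_{T_j|S_j}` (here
`pT j`) and the decoders `h_j` attain the Wyner-Ziv function at `D_j`. -/
def separateConfigurations (sys : System S Shat X Y) (D : Bool → ℝ) :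
    Set (Configuration S Shat X Y (fun j => V j × T j)) :=
  {c | c ∈ sys.configurations D ∧
    ∃ (pV : ∀ j, V j → ℝ) (pT : ∀ j, S j → T j → ℝ)
      (q : (∀ j, V j) → (∀ j, X j × Y j) → ℝ)
      (γ : ∀ j, V j → V j → X j × Y j → X j)
      (h : ∀ j, T j → S (!j) → Shat j),
      (∀ j, pV j ∈ stdSimplex ℝ (V j)) ∧
      (∀ j s, pT j s ∈ stdSimplex ℝ (T j)) ∧
      (∀ v, q v ∈ stdSimplex ℝ (∀ j, X j × Y j)) ∧
      (∀ j, Fintype.card (T j) ≤ Fintype.card (S j) + 1) ∧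
      (∀ j, sys.wzDistortion j (pT j) (h j) ≤ D j ∧
        (sys.wzInfo j (pT j) : EReal) = sys.wzRate j (D j)) ∧
      (∀ j s v t, c.PU j s (v, t) = pV j v * pT j s t) ∧
      (∀ s u, c.PT (s, u) = sys.src s * ∏ j, pV j (u j).1 * pT j (s j) (u j).2) ∧
      (∀ s u, c.PW s u = q (fun j => (u j).1)) ∧
      (∀ j s u s' u' w, c.F j s u s' u' w = γ j u.1 u'.1 w) ∧
      (∀ j u' s u s' u'' w y, c.G j u' s u s' u'' w y = h j u'.2 s')}

/-- Han's adaptive channel coding rate `I(Ṽ_j; X_{j'}, Y_{j'}, Ṽ_{j'}, W̃_{j'})` of the configuration `c`,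
computed under its stationary distribution. -/
def hanRate (sys : System S Shat X Y) (c : Configuration S Shat X Y (fun j => V j × T j)) (j : Bool) : ℝ :=
  mutualInfo (c.PZ sys) (fun z => (z.uT j).1)
    (fun z => (z.x (!j), z.y (!j), (z.uT (!j)).1, z.wT (!j)))

end System

end TwoWay

end

noncomputable section

namespace TwoWay

/-! ### Finite probability -/

section FiniteProbability

/-! Each terminal quantises its source block with a random Wyner-Ziv codebook of about exp(K
I(S_j;T_j)) words, and every word gets its own random channel codeword; there is no explicit
binning. The other terminal looks for an index that is compatible with its side information and
whose channel codeword passes a likelihood test. On average about exp(K I(S_j;T_j|S_{j'})) indices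
are compatible, and a wrong one passes the test with probability at most exp(-K r), so decoding
succeeds with high probability once r exceeds the Wyner-Ziv information while the true codeword
still passes. The source half is `exists_wz_codebook`, resting on the covering argument
`exists_source_codebook`; the channel half is `exists_channel_codebook`.

The Markov chain of Han's scheme need not be ergodic, so no law of large numbers is applied along
it. The channel uses are instead cut into n blocks of L + 1, and at the start of each block the
memories are reset to values drawn from the stationary law and then frozen. A memory only feeds the
terminal's own encoder, so a reset costs no channel use. In the random ensemble the blocks are
i.i.d., and inside a block the chain is stationary (`sum_pathWeight_mul`), so the mean
log-likelihood ratio of a block is exactly L times Han's rate (`sum_blockLaw_log`). A letter is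
tested through the view one use later, so the last letter of a block yields nothing; a large L makes
this loss negligible. A Chernoff bound (`exists_pow_bound_prod`) makes failure of the true codeword
exponentially rare (`exists_passes_tail`), and a change of measure bounds false acceptance
(`sum_passes_le`).

`eventually_exists_code` joins the two halves. `IsSeparate` projects a configuration onto its
`HanScheme`, preserving stationarity and rate. -/

/-- The indicator of a proposition, as a real number. -/
def ind (p : Prop) : ℝ := open Classical in if p then 1 else 0

lemma ind_of {p : Prop} (h : p) : ind p = 1 := if_pos h

lemma ind_of_not {p : Prop} (h : ¬p) : ind p = 0 := if_neg h

lemma ind_nonneg (p : Prop) : 0 ≤ ind p := by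
  by_cases h : p
  · simp [ind_of h]
  · simp [ind_of_not h]

lemma ind_le_one (p : Prop) : ind p ≤ 1 := by
  by_cases h : p
  · simp [ind_of h]
  · simp [ind_of_not h]

lemma ind_le {p : Prop} {x : ℝ} (hx : 0 ≤ x) (h : p → 1 ≤ x) : ind p ≤ x := by
  by_cases hp : p
  · simpa [ind_of hp] using h hp
  · simpa [ind_of_not hp] using hx

lemma ind_le_ind {p q : Prop} (h : p → q) : ind p ≤ ind q :=
  ind_le (ind_nonneg q) fun hp => (ind_of (h hp)).ge

lemma ind_or_le (p q : Prop) : ind (p ∨ q) ≤ ind p + ind q := by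
  refine ind_le (add_nonneg (ind_nonneg _) (ind_nonneg _)) ?_
  rintro (h | h)
  · linarith [ind_of h, ind_nonneg q]
  · linarith [ind_of h, ind_nonneg p]

lemma ind_exists_le {ι : Type*} [Fintype ι] (p : ι → Prop) : ind (∃ i, p i) ≤ ∑ i, ind (p i) := by
  refine ind_le (Finset.sum_nonneg fun i _ => ind_nonneg _) ?_
  rintro ⟨i, hi⟩
  calc (1 : ℝ) = ind (p i) := (ind_of hi).symm
    _ ≤ _ := Finset.single_le_sum (f := fun i => ind (p i)) (fun i _ => ind_nonneg _) (Finset.mem_univ i)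

lemma ind_and (p q : Prop) : ind (p ∧ q) = ind p * ind q := by
  by_cases hp : p <;> by_cases hq : q <;> simp [ind, hp, hq]

lemma ind_not (p : Prop) : ind (¬p) = 1 - ind p := by
  by_cases hp : p <;> simp [ind, hp]

/-- The averaging step of random coding. With `f = 0` it also serves to extract a point from a type
that carries a probability law. -/
lemma exists_le_of_sum_mul_le {ι : Type*} [Fintype ι] {w f : ι → ℝ} {c : ℝ}
    (hw : w ∈ stdSimplex ℝ ι) (h : ∑ i, w i * f i ≤ c) : ∃ i, f i ≤ c := by
  by_contra! hc
  obtain ⟨i, hi⟩ : ∃ i, 0 < w i := by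
    by_contra! hn
    have := Finset.sum_nonpos fun i (_ : i ∈ Finset.univ) => hn i
    rw [hw.2] at this
    linarith
  have : ∑ i, w i * c < ∑ i, w i * f i :=
    Finset.sum_lt_sum (fun k _ => mul_le_mul_of_nonneg_left (hc k).le (hw.1 k))
      ⟨i, Finset.mem_univ i, mul_lt_mul_of_pos_left (hc i) hi⟩
  rw [← Finset.sum_mul, hw.2] at this
  linarith

lemma prod_mem_stdSimplex {ι : Type*} [Fintype ι] [DecidableEq ι] {α : ι → Type*} [∀ i, Fintype (α i)]
    {p : ∀ i, α i → ℝ} (hp : ∀ i, p i ∈ stdSimplex ℝ (α i)) :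
    (fun f : ∀ i, α i => ∏ i, p i (f i)) ∈ stdSimplex ℝ (∀ i, α i) := by
  refine ⟨fun f => Finset.prod_nonneg fun i _ => (hp i).1 _, ?_⟩
  rw [← Fintype.prod_sum]
  exact Finset.prod_eq_one fun i _ => (hp i).2

/-- A coordinate of a product distribution may be replaced by an independent copy. -/
lemma sum_prod_mul_resample {ι : Type*} [Fintype ι] [DecidableEq ι] {α : ι → Type*}
    [∀ i, Fintype (α i)] (p : ∀ i, α i → ℝ) (i : ι) (hp : ∑ a, p i a = 1) (F : (∀ i, α i) → ℝ) :
    ∑ f : ∀ i, α i, (∏ k, p k (f k)) * F f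
      = ∑ f : ∀ i, α i, (∏ k, p k (f k)) * ∑ a, p i a * F (Function.update f i a) := by
  have key : ∑ x : (∀ i, α i) × α i, (∏ k, p k (x.1 k)) * p i x.2 * F x.1
      = ∑ x : (∀ i, α i) × α i, (∏ k, p k (x.1 k)) * p i x.2 * F (Function.update x.1 i x.2) := by
    -- Exchanging coordinate `i` with the fresh copy is a weight-preserving involution.
    refine Finset.sum_nbij' (fun x => (Function.update x.1 i x.2, x.1 i))
      (fun x => (Function.update x.1 i x.2, x.1 i)) (by simp) (by simp) ?_ ?_ ?_
    · intro x _; simp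
    · intro x _; simp
    · intro x _
      simp only [Function.update_idem, Function.update_eq_self]
      congr 1
      rw [← Finset.mul_prod_erase _ _ (Finset.mem_univ i),
        ← Finset.mul_prod_erase (a := i) _ (fun k => p k (Function.update x.1 i x.2 k)) (Finset.mem_univ i)]
      have : ∏ k ∈ Finset.univ.erase i, p k (Function.update x.1 i x.2 k)
          = ∏ k ∈ Finset.univ.erase i, p k (x.1 k) :=
        Finset.prod_congr rfl fun k hk => by
          rw [Function.update_of_ne (Finset.ne_of_mem_erase hk)]
      rw [this, Function.update_self]
      ring
  rw [Fintype.sum_prod_type, Fintype.sum_prod_type] at key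
  calc _ = ∑ f : ∀ i, α i, ∑ a, (∏ k, p k (f k)) * p i a * F f := by
        refine Finset.sum_congr rfl fun f _ => ?_
        rw [← Finset.sum_mul, ← Finset.mul_sum, hp, mul_one]
    _ = _ := by
        rw [key]
        refine Finset.sum_congr rfl fun f _ => ?_
        rw [Finset.mul_sum]
        exact Finset.sum_congr rfl fun a _ => by ring

/-- Chernoff's bound: the moment generating function is 1 at 0 with derivative the negative mean, so
it is below 1 at some θ > 0, and that value is ρ. -/
lemma exists_pow_bound {Ω : Type*} [Fintype Ω] {P : Ω → ℝ} (hP : P ∈ stdSimplex ℝ Ω) {g : Ω → ℝ}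
    (hg : ∑ ω, P ω * g ω < 0) :
    ∃ ρ : ℝ, 0 ≤ ρ ∧ ρ < 1 ∧ ∀ n : ℕ,
      ∑ ω : Fin n → Ω, (∏ i, P (ω i)) * ind (0 ≤ ∑ i, g (ω i)) ≤ ρ ^ n := by
  set φ : ℝ → ℝ := fun θ => ∑ ω, P ω * Real.exp (θ * g ω) with hφ
  have hφ0 : φ 0 = 1 := by simp [hφ, hP.2]
  have hd : HasDerivAt φ (∑ ω, P ω * g ω) 0 := by
    have h : ∀ ω ∈ Finset.univ, HasDerivAt (fun θ : ℝ => P ω * Real.exp (θ * g ω)) (P ω * g ω) 0 := by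
      intro ω _
      have := (((hasDerivAt_id (0 : ℝ)).mul_const (g ω)).exp).const_mul (P ω)
      simpa using this
    exact HasDerivAt.fun_sum h
  obtain ⟨θ, hθ0, hθ⟩ : ∃ θ : ℝ, 0 < θ ∧ φ θ < 1 := by
    have h1 := hd.tendsto_slope
    have h2 : ∀ᶠ θ in 𝓝[>] (0 : ℝ), slope φ 0 θ < 0 :=
      (h1.mono_left (nhdsWithin_mono _ fun x hx => ne_of_gt hx)).eventually (gt_mem_nhds hg)
    obtain ⟨θ, h3, h4⟩ := (h2.and self_mem_nhdsWithin).exists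
    refine ⟨θ, h4, ?_⟩
    rw [slope_def_field, hφ0, sub_zero, div_neg_iff] at h3
    have : (0 : ℝ) < θ := h4
    rcases h3 with h | h <;> linarith [h.1, h.2]
  refine ⟨φ θ, Finset.sum_nonneg fun ω _ => mul_nonneg (hP.1 ω) (Real.exp_pos _).le, hθ, fun n => ?_⟩
  rw [hφ]
  simp only
  rw [Fintype.sum_pow]
  refine Finset.sum_le_sum fun ω _ => ?_
  rw [Finset.prod_mul_distrib]
  refine mul_le_mul_of_nonneg_left ?_ (Finset.prod_nonneg fun i _ => hP.1 _)
  rw [← Real.exp_sum, ← Finset.mul_sum]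
  exact ind_le (Real.exp_pos _).le fun h => Real.one_le_exp (mul_nonneg hθ0.le h)

/-- Weak law of large numbers for likelihood ratios, with an exponential rate. -/
lemma exists_pow_bound_prod {Ω : Type*} [Fintype Ω] {P : Ω → ℝ} (hP : P ∈ stdSimplex ℝ Ω)
    {u v : Ω → ℝ} (hu : ∀ ω, 0 < P ω → 0 < u ω) (hv : ∀ ω, 0 < P ω → 0 < v ω) {c : ℝ}
    (h : ∑ ω, P ω * (Real.log (u ω) - Real.log (v ω)) < c) :
    ∃ ρ : ℝ, 0 ≤ ρ ∧ ρ < 1 ∧ ∀ n : ℕ,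
      ∑ ω : Fin n → Ω, (∏ i, P (ω i)) * ind (¬ ∏ i, u (ω i) ≤ Real.exp (n * c) * ∏ i, v (ω i)) ≤ ρ ^ n := by
  obtain ⟨ρ, h0, h1, hρ⟩ := exists_pow_bound hP
    (g := fun ω => Real.log (u ω) - Real.log (v ω) - c) (by
      simp only [mul_sub, Finset.sum_sub_distrib, ← Finset.sum_mul, hP.2, one_mul] at h ⊢
      linarith)
  refine ⟨ρ, h0, h1, fun n => (Finset.sum_le_sum fun ω _ => ?_).trans (hρ n)⟩
  -- `u` and `v` are known to be positive only on the support of `P`; sequences leaving the support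
  -- have weight zero.
  by_cases hpos : ∀ i, 0 < P (ω i)
  · refine mul_le_mul_of_nonneg_left (ind_le_ind fun hlt => ?_) (Finset.prod_nonneg fun i _ => hP.1 _)
    have hu' : ∀ i, 0 < u (ω i) := fun i => hu _ (hpos i)
    have hv' : ∀ i, 0 < v (ω i) := fun i => hv _ (hpos i)
    by_contra! hneg
    apply hlt
    have e : ∑ i, (Real.log (u (ω i)) - Real.log (v (ω i)) - c)
        = Real.log (∏ i, u (ω i)) - Real.log (∏ i, v (ω i)) - n * c := by
      rw [Real.log_prod fun i _ => (hu' i).ne', Real.log_prod fun i _ => (hv' i).ne']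
      simp [Finset.sum_sub_distrib]
    rw [e] at hneg
    have hU : 0 < ∏ i, u (ω i) := Finset.prod_pos fun i _ => hu' i
    have hV : 0 < ∏ i, v (ω i) := Finset.prod_pos fun i _ => hv' i
    rw [← Real.exp_log hU, ← Real.exp_log hV, ← Real.exp_add]
    exact Real.exp_le_exp.2 (by linarith)
  · push Not at hpos
    obtain ⟨i, hi⟩ := hpos
    have : ∏ i, P (ω i) = 0 := Finset.prod_eq_zero (Finset.mem_univ i) (le_antisymm hi (hP.1 _))
    simp [this]

end FiniteProbability

/-! ### Information measures as expected log-ratios -/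

section Information

variable {Ω α β : Type*} [Fintype Ω]

lemma law_eq (p : Ω → ℝ) (A : Ω → α) (a : α) : law p A a = ∑ ω, p ω * ind (A ω = a) := by
  unfold law ind
  exact Finset.sum_congr rfl fun ω _ => by split_ifs <;> simp

lemma sum_law_mul [Fintype α] (p : Ω → ℝ) (A : Ω → α) (f : α → ℝ) :
    ∑ a, law p A a * f a = ∑ ω, p ω * f (A ω) := by
  classical
  simp only [law, Finset.sum_mul]
  rw [Finset.sum_comm]
  refine Finset.sum_congr rfl fun ω _ => ?_
  rw [Finset.sum_eq_single (A ω)]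
  · simp
  · intro b _ hb; simp [hb.symm]
  · simp

lemma entropy_eq [Fintype α] (p : Ω → ℝ) (A : Ω → α) :
    entropy p A = - ∑ ω, p ω * Real.log (law p A (A ω)) := by
  rw [← sum_law_mul p A fun a => Real.log (law p A a)]
  simp [entropy, Real.negMulLog]

lemma law_nonneg {p : Ω → ℝ} (hp : ∀ ω, 0 ≤ p ω) (A : Ω → α) (a : α) : 0 ≤ law p A a := by
  rw [law_eq]
  exact Finset.sum_nonneg fun ω _ => mul_nonneg (hp ω) (ind_nonneg _)

lemma law_pos {p : Ω → ℝ} (hp : ∀ ω, 0 ≤ p ω) (A : Ω → α) {ω : Ω} (h : 0 < p ω) :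
    0 < law p A (A ω) := by
  rw [law_eq]
  refine Finset.sum_pos' (fun ω _ => mul_nonneg (hp ω) (ind_nonneg _)) ⟨ω, Finset.mem_univ ω, ?_⟩
  rw [ind_of rfl, mul_one]
  exact h

lemma law_mem_stdSimplex [Fintype α] {p : Ω → ℝ} (hp : p ∈ stdSimplex ℝ Ω) (A : Ω → α) :
    law p A ∈ stdSimplex ℝ α := by
  refine ⟨law_nonneg hp.1 A, ?_⟩
  have := sum_law_mul p A fun _ => 1
  simpa [hp.2] using this

lemma sum_law_prod [Fintype α] (p : Ω → ℝ) (A : Ω → α) (B : Ω → β) (b : β) :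
    ∑ a, law p (fun ω => (A ω, B ω)) (a, b) = law p B b := by
  classical
  simp only [law]
  rw [Finset.sum_comm]
  refine Finset.sum_congr rfl fun ω _ => ?_
  rw [Finset.sum_eq_single (A ω)]
  · simp
  · intro a _ ha; simp [ha.symm]
  · simp

/-- The conditional law of `A` given `B`; it vanishes where `B` has probability zero. -/
def condLaw (p : Ω → ℝ) (A : Ω → α) (B : Ω → β) (b : β) (a : α) : ℝ :=
  law p (fun ω => (A ω, B ω)) (a, b) / law p B b

lemma condLaw_nonneg {p : Ω → ℝ} (hp : ∀ ω, 0 ≤ p ω) (A : Ω → α) (B : Ω → β) (b : β) (a : α) :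
    0 ≤ condLaw p A B b a :=
  div_nonneg (law_nonneg hp _ _) (law_nonneg hp _ _)

lemma sum_condLaw_le_one [Fintype α] (p : Ω → ℝ) (A : Ω → α) (B : Ω → β) (b : β) :
    ∑ a, condLaw p A B b a ≤ 1 := by
  simp only [condLaw]
  rw [← Finset.sum_div, sum_law_prod]
  exact div_self_le_one _

lemma condLaw_pos {p : Ω → ℝ} (hp : ∀ ω, 0 ≤ p ω) (A : Ω → α) (B : Ω → β) {ω : Ω} (h : 0 < p ω) :
    0 < condLaw p A B (B ω) (A ω) :=
  div_pos (law_pos hp (fun ω => (A ω, B ω)) h) (law_pos hp B h)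

/-- In this form mutual information is the mean of the statistic used by a likelihood test. Points
of probability zero contribute nothing, so the junk values of `Real.log` are harmless. -/
lemma mutualInfo_eq [Fintype α] [Fintype β] {p : Ω → ℝ} (hp : ∀ ω, 0 ≤ p ω) (A : Ω → α) (B : Ω → β) :
    mutualInfo p A B
      = ∑ ω, p ω * (Real.log (condLaw p A B (B ω) (A ω)) - Real.log (law p A (A ω))) := by
  rw [mutualInfo, entropy_eq, entropy_eq, entropy_eq, ← sub_eq_zero]
  simp only [mul_sub, Finset.sum_sub_distrib]
  have : ∑ ω, p ω * Real.log (condLaw p A B (B ω) (A ω))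
      = ∑ ω, p ω * Real.log (law p (fun ω => (A ω, B ω)) (A ω, B ω))
        - ∑ ω, p ω * Real.log (law p B (B ω)) := by
    rw [← Finset.sum_sub_distrib]
    refine Finset.sum_congr rfl fun ω _ => ?_
    rcases (hp ω).eq_or_lt with h | h
    · simp [← h]
    · rw [condLaw, Real.log_div (law_pos hp (fun ω => (A ω, B ω)) h).ne' (law_pos hp B h).ne', mul_sub]
  rw [this]
  ring

end Information

/-! ### Random covering for the source -/

section SourceCodebook

/-- The probability that `M` independent codewords all miss a set of conditional mass `x`. The power
is at most exp(-xM/γ), and convexity of `exp` bounds this by the chord from 0 to -M/γ, which is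
linear in `x` and can therefore be averaged. -/
lemma one_sub_div_pow_le {q x γ : ℝ} (hq : 0 ≤ q) (hx0 : 0 ≤ x) (hx1 : x ≤ 1) (h : q ≤ 1 - x / γ)
    (M : ℕ) : q ^ M ≤ 1 - x + Real.exp (-(M / γ)) := by
  have h1 : q ≤ Real.exp (-(x / γ)) := h.trans (Real.one_sub_le_exp_neg _)
  have h2 : q ^ M ≤ Real.exp ((1 - x) • 0 + x • (-(M / γ))) := by
    refine (pow_le_pow_left₀ hq h1 M).trans (le_of_eq ?_)
    rw [← Real.exp_nat_mul]
    congr 1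
    simp only [smul_eq_mul]
    ring
  have h3 := convexOn_exp.2 (Set.mem_univ (0 : ℝ)) (Set.mem_univ (-(M / γ) : ℝ)) (sub_nonneg.2 hx1) hx0
    (by ring)
  simp only [smul_eq_mul, Real.exp_zero, mul_one] at h2 h3
  nlinarith [Real.exp_pos (-(M / γ) : ℝ)]

/-- One-shot random covering. The codewords of a random codebook drawn from `Q` include one that is
jointly good with the source and the side information, while the expected number of codewords that are
compatible with the side information stays small. -/
lemma exists_source_codebook {Ω A B T : Type*} [Fintype Ω] [Fintype A] [Fintype T]
    {P : Ω → ℝ} (hP : P ∈ stdSimplex ℝ Ω) (a : Ω → A) (b : Ω → B)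
    {p : A → T → ℝ} (hp : ∀ x, p x ∈ stdSimplex ℝ T) {Q : T → ℝ} (hQ : Q ∈ stdSimplex ℝ T)
    (G : A → T → B → Prop) (cmp : T → B → Prop) {γ β δ η c : ℝ} (hγ : 0 < γ)
    (hG : ∀ x t y, G x t y → p x t ≤ γ * Q t) (hcmp : ∀ y, ∑ t, Q t * ind (cmp t y) ≤ β)
    (hδ : ∑ ω, ∑ t, P ω * p (a ω) t * ind (¬G (a ω) t (b ω)) ≤ δ)
    (hη0 : 0 < η) (hη1 : η < 1) (hc : 0 ≤ c) (M : ℕ) (hM : 0 < M) :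
    ∃ (cb : Fin M → T) (k : A → Fin M),
      ∑ ω, P ω * (ind (¬G (a ω) (cb (k (a ω))) (b ω)) + c * ∑ m, ind (cmp (cb m) (b ω)))
        ≤ η + δ / η + Real.exp (-(M / γ)) + c * (M * β) := by
  classical
  have : Nonempty (Fin M) := ⟨⟨0, hM⟩⟩
  -- The probability that the observation is `x` and that `t` then fails. The encoder does not see
  -- the side information, so it picks the codeword minimising this quantity.
  set φ : A → T → ℝ := fun x t => ∑ ω, P ω * ind (a ω = x) * ind (¬G x t (b ω)) with hφ
  set PA : A → ℝ := fun x => law P a x with hPA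
  have hPA0 : ∀ x, 0 ≤ PA x := law_nonneg hP.1 a
  have hPA1 : ∑ x, PA x = 1 := (law_mem_stdSimplex hP a).2
  have hφ0 : ∀ x t, 0 ≤ φ x t := fun x t =>
    Finset.sum_nonneg fun ω _ => mul_nonneg (mul_nonneg (hP.1 ω) (ind_nonneg _)) (ind_nonneg _)
  have hφ1 : ∀ x t, φ x t ≤ PA x := fun x t => by
    rw [hPA]
    simp only [law_eq]
    exact Finset.sum_le_sum fun ω _ =>
      mul_le_of_le_one_right (mul_nonneg (hP.1 ω) (ind_nonneg _)) (ind_le_one _)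
  have collapse : ∀ F : A → Ω → ℝ, ∑ x, ∑ ω, P ω * ind (a ω = x) * F x ω = ∑ ω, P ω * F (a ω) ω := by
    intro F
    rw [Finset.sum_comm]
    refine Finset.sum_congr rfl fun ω _ => ?_
    rw [Finset.sum_eq_single (a ω)]
    · rw [ind_of rfl, mul_one]
    · intro x _ hx; rw [ind_of_not hx.symm, mul_zero, zero_mul]
    · simp
  have hk : ∀ cb : Fin M → T, ∃ k : A → Fin M, ∀ x m, φ x (cb (k x)) ≤ φ x (cb m) := fun cb => by
    choose k hk using fun x => Finite.exists_min fun m => φ x (cb m)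
    exact ⟨k, hk⟩
  choose k hk using hk
  suffices h : ∑ cb : Fin M → T, (∏ m, Q (cb m)) *
      ∑ ω, P ω * (ind (¬G (a ω) (cb (k cb (a ω))) (b ω)) + c * ∑ m, ind (cmp (cb m) (b ω)))
        ≤ η + δ / η + Real.exp (-(M / γ)) + c * (M * β) by
    obtain ⟨cb, hcb⟩ := exists_le_of_sum_mul_le (prod_mem_stdSimplex fun _ : Fin M => hQ) h
    exact ⟨cb, k cb, hcb⟩
  have hw : (fun cb : Fin M → T => ∏ m, Q (cb m)) ∈ stdSimplex ℝ (Fin M → T) :=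
    prod_mem_stdSimplex fun _ : Fin M => hQ
  have hw0 : ∀ cb : Fin M → T, 0 ≤ ∏ m, Q (cb m) := hw.1
  have hw1 : ∑ cb : Fin M → T, ∏ m, Q (cb m) = 1 := hw.2
  have hcover : ∑ cb : Fin M → T, (∏ m, Q (cb m)) *
      ∑ ω, P ω * ind (¬G (a ω) (cb (k cb (a ω))) (b ω)) ≤ η + δ / η + Real.exp (-(M / γ)) := by
    have h1 : ∀ cb : Fin M → T, ∑ ω, P ω * ind (¬G (a ω) (cb (k cb (a ω))) (b ω))
        ≤ ∑ x, PA x * (η + ∏ m, ind (η * PA x < φ x (cb m))) := by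
      intro cb
      rw [← collapse fun x ω => ind (¬G x (cb (k cb x)) (b ω))]
      refine Finset.sum_le_sum fun x _ => ?_
      change φ x (cb (k cb x)) ≤ _
      -- Either every codeword has conditional failure probability above η, and the product of
      -- indicators is 1, or the minimiser fails with conditional probability at most η.
      by_cases hall : ∀ m, η * PA x < φ x (cb m)
      · rw [Finset.prod_eq_one fun m _ => ind_of (hall m)]
        nlinarith [hφ1 x (cb (k cb x)), hPA0 x]
      · push Not at hall
        obtain ⟨m, hm⟩ := hall
        have : 0 ≤ ∏ m, ind (η * PA x < φ x (cb m)) := Finset.prod_nonneg fun m _ => ind_nonneg _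
        nlinarith [hk cb x m, hPA0 x, mul_nonneg (hPA0 x) this]
    have h2 : ∀ x, PA x * (∑ t, Q t * ind (η * PA x < φ x t)) ^ M
        ≤ (∑ t, p x t * φ x t) / η + PA x * Real.exp (-(M / γ)) := by
      intro x
      rcases (hPA0 x).eq_or_lt with h0 | hpos
      · rw [← h0, zero_mul, zero_mul, add_zero]
        exact div_nonneg (Finset.sum_nonneg fun t _ => mul_nonneg ((hp x).1 t) (hφ0 x t)) hη0.le
      -- As η < 1, such a `t` does not fail always, so `G` holds somewhere and brings its density
      -- bound.
      have hgood : ∀ t, ¬ η * PA x < φ x t → p x t ≤ γ * Q t := by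
        intro t ht
        by_contra hcon
        have hnG : ∀ ω, ¬ G x t (b ω) := fun ω hω => hcon (hG _ _ _ hω)
        have : φ x t = PA x := by
          simp only [hφ, hPA, law_eq]
          exact Finset.sum_congr rfl fun ω _ => by rw [ind_of (hnG ω), mul_one]
        rw [this] at ht
        nlinarith
      set X := ∑ t, p x t * ind (¬ η * PA x < φ x t) with hX
      have hX1 : 1 - X = ∑ t, p x t * ind (η * PA x < φ x t) := by
        rw [hX, ← (hp x).2, ← Finset.sum_sub_distrib]
        exact Finset.sum_congr rfl fun t _ => by rw [ind_not]; ring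
      -- Markov's inequality for the conditional failure probability under `p x`.
      have hXle : 1 - X ≤ (∑ t, p x t * φ x t) / η / PA x := by
        rw [hX1, le_div_iff₀ hpos, le_div_iff₀ hη0, Finset.sum_mul, Finset.sum_mul]
        refine Finset.sum_le_sum fun t _ => ?_
        rw [mul_assoc, mul_assoc]
        refine mul_le_mul_of_nonneg_left ?_ ((hp x).1 t)
        by_cases hb : η * PA x < φ x t
        · rw [ind_of hb]; nlinarith
        · rw [ind_of_not hb, zero_mul]; exact hφ0 x t
      -- Change of measure from `p x` to `Q`, costing a factor γ on the words covered by `hgood`.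
      have hq : ∑ t, Q t * ind (η * PA x < φ x t) ≤ 1 - X / γ := by
        rw [le_sub_comm, div_le_iff₀ hγ, ← hQ.2, ← Finset.sum_sub_distrib, Finset.sum_mul]
        refine Finset.sum_le_sum fun t _ => ?_
        by_cases hb : η * PA x < φ x t
        · rw [ind_of hb, ind_of_not (not_not.2 hb)]; simp
        · rw [ind_of_not hb, ind_of hb]; linarith [hgood t hb]
      have := one_sub_div_pow_le (M := M)
        (Finset.sum_nonneg fun t _ => mul_nonneg (hQ.1 t) (ind_nonneg _))
        (Finset.sum_nonneg fun t _ => mul_nonneg ((hp x).1 t) (ind_nonneg _))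
        (by linarith [hX1, Finset.sum_nonneg fun t (_ : t ∈ Finset.univ) =>
          mul_nonneg ((hp x).1 t) (ind_nonneg (η * PA x < φ x t))]) hq
      calc _ ≤ PA x * ((∑ t, p x t * φ x t) / η / PA x + Real.exp (-(M / γ))) :=
            mul_le_mul_of_nonneg_left (by linarith) hpos.le
        _ = _ := by field_simp
    have h3 : ∑ x, ∑ t, p x t * φ x t ≤ δ := by
      refine le_trans (le_of_eq ?_) hδ
      have := collapse fun x ω => ∑ t, p x t * ind (¬G x t (b ω))
      simp only [Finset.mul_sum] at this
      rw [show ∑ ω, ∑ t, P ω * p (a ω) t * ind (¬G (a ω) t (b ω))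
        = ∑ ω, ∑ t, P ω * (p (a ω) t * ind (¬G (a ω) t (b ω))) by simp only [mul_assoc], ← this]
      refine Finset.sum_congr rfl fun x _ => ?_
      rw [Finset.sum_comm]
      refine Finset.sum_congr rfl fun t _ => ?_
      rw [hφ, Finset.mul_sum]
      exact Finset.sum_congr rfl fun ω _ => by ring
    calc _ ≤ ∑ cb : Fin M → T, (∏ m, Q (cb m)) * ∑ x, PA x * (η + ∏ m, ind (η * PA x < φ x (cb m))) :=
          Finset.sum_le_sum fun cb _ => mul_le_mul_of_nonneg_left (h1 cb) (hw0 cb)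
      _ = ∑ x, PA x * (η + (∑ t, Q t * ind (η * PA x < φ x t)) ^ M) := by
          simp only [Finset.mul_sum]
          rw [Finset.sum_comm]
          refine Finset.sum_congr rfl fun x _ => ?_
          rw [Fintype.sum_pow]
          simp only [Finset.prod_mul_distrib]
          rw [mul_add, Finset.mul_sum]
          simp only [mul_add, Finset.sum_add_distrib]
          congr 1
          · rw [← Finset.sum_mul, hw1, one_mul]
          · exact Finset.sum_congr rfl fun cb _ => by ring
      _ ≤ ∑ x, (η * PA x + (∑ t, p x t * φ x t) / η + PA x * Real.exp (-(M / γ))) :=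
          Finset.sum_le_sum fun x _ => by linarith [h2 x]
      _ = η + (∑ x, ∑ t, p x t * φ x t) / η + Real.exp (-(M / γ)) := by
          rw [Finset.sum_add_distrib, Finset.sum_add_distrib, ← Finset.mul_sum, ← Finset.sum_mul, hPA1,
            ← Finset.sum_div]
          ring
      _ ≤ _ := by gcongr
  have hpack : ∑ cb : Fin M → T, (∏ m, Q (cb m)) * ∑ ω, P ω * (c * ∑ m, ind (cmp (cb m) (b ω)))
      ≤ c * (M * β) := by
    have hm : ∀ ω (m : Fin M), ∑ cb : Fin M → T, (∏ m, Q (cb m)) * ind (cmp (cb m) (b ω)) ≤ β := by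
      intro ω m
      rw [sum_prod_mul_resample (fun _ => Q) m hQ.2 fun cb => ind (cmp (cb m) (b ω))]
      simp only [Function.update_self]
      rw [← Finset.sum_mul, hw1, one_mul]
      exact hcmp _
    calc _ = ∑ ω, P ω * (c * ∑ m, ∑ cb : Fin M → T, (∏ m, Q (cb m)) * ind (cmp (cb m) (b ω))) := by
          simp only [Finset.mul_sum]
          rw [Finset.sum_comm]
          refine Finset.sum_congr rfl fun ω _ => ?_
          rw [Finset.sum_comm]
          exact Finset.sum_congr rfl fun m _ => Finset.sum_congr rfl fun cb _ => by ring
      _ ≤ ∑ ω, P ω * (c * ∑ _m : Fin M, β) := by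
          gcongr with ω _ m _
          · exact hP.1 ω
          · exact hm ω m
      _ = _ := by rw [← Finset.sum_mul, hP.2]; simp
  calc _ = _ := by
        simp only [mul_add, Finset.sum_add_distrib]
    _ ≤ _ := add_le_add hcover hpack

end SourceCodebook

/-! ### Random coding for the two-way channel -/

section ChannelCodebook

/-- Only one codeword per terminal is sent. Expanding `F` in point masses turns the integrand into a
product over all codewords, and those not sent sum to one. -/
lemma sum_prod_mul_comp_section {J : Type*} [Fintype J] [DecidableEq J] {ι C : J → Type*} [∀ j, Fintype (ι j)]
    [∀ j, DecidableEq (ι j)] [∀ j, Fintype (C j)] {p : ∀ j, C j → ℝ} (hp : ∀ j, ∑ c, p j c = 1)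
    (k : ∀ j, ι j) (F : (∀ j, C j) → ℝ) :
    ∑ f : ∀ x : (Σ j, ι j), C x.1, (∏ x, p x.1 (f x)) * F (fun j => f ⟨j, k j⟩)
      = ∑ c : ∀ j, C j, (∏ j, p j (c j)) * F c := by
  classical
  have h1 : ∀ f : ∀ x : (Σ j, ι j), C x.1, F (fun j => f ⟨j, k j⟩)
      = ∑ c : ∀ j, C j, F c * ∏ x : (Σ j, ι j), ind (x.2 = k x.1 → f x = c x.1) := by
    intro f
    rw [Finset.sum_eq_single (fun j => f ⟨j, k j⟩)]
    · rw [Finset.prod_eq_one, mul_one]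
      rintro ⟨j, m⟩ -
      refine ind_of fun h => ?_
      change m = k j at h
      subst h
      rfl
    · intro c _ hc
      obtain ⟨j, hj⟩ := Function.ne_iff.1 hc
      rw [Finset.prod_eq_zero (Finset.mem_univ (⟨j, k j⟩ : Σ j, ι j)), mul_zero]
      exact ind_of_not fun h => hj (h rfl).symm
    · simp
  simp only [h1, Finset.mul_sum]
  rw [Finset.sum_comm]
  refine Finset.sum_congr rfl fun c _ => ?_
  calc _ = F c * ∑ f : ∀ x : (Σ j, ι j), C x.1, ∏ x, p x.1 (f x) * ind (x.2 = k x.1 → f x = c x.1) := by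
        rw [Finset.mul_sum]
        exact Finset.sum_congr rfl fun f _ => by rw [Finset.prod_mul_distrib]; ring
    _ = F c * ∏ x : (Σ j, ι j), ∑ a, p x.1 a * ind (x.2 = k x.1 → a = c x.1) := by
        rw [Fintype.prod_sum]
    _ = F c * ∏ x : (Σ j, ι j), if x.2 = k x.1 then p x.1 (c x.1) else 1 := by
        congr 1
        refine Finset.prod_congr rfl fun x _ => ?_
        split_ifs with h
        · rw [Finset.sum_eq_single (c x.1)]
          · rw [ind_of fun _ => rfl, mul_one]
          · intro a _ ha
            rw [ind_of_not fun h' => ha (h' h), mul_zero]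
          · simp
        · rw [← hp x.1]
          exact Finset.sum_congr rfl fun a _ => by rw [ind_of fun h' => absurd h' h, mul_one]
    _ = _ := by
        rw [Fintype.prod_sigma, mul_comm]
        simp

/-- One-shot random coding for a two-way channel. Both terminals know the realization of `Z` and their own
codeword; terminal `!j` searches the codeword of terminal `j` among the candidates allowed by its source block. -/
lemma exists_channel_codebook {ι A C : Bool → Type*} {Z O : Type*} [∀ j, Fintype (ι j)]
    [∀ j, Fintype (A j)] [∀ j, Fintype (C j)] [Fintype Z] [Fintype O]
    {P : (∀ j, A j) → ℝ} (hP : P ∈ stdSimplex ℝ (∀ j, A j)) (k : ∀ j, A j → ι j)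
    (cand : ∀ j, ι j → A (!j) → Prop)
    {pC : ∀ j, C j → ℝ} (hpC : ∀ j, pC j ∈ stdSimplex ℝ (C j)) {μ : Z → ℝ} (hμ : μ ∈ stdSimplex ℝ Z)
    {W : Z → (∀ j, C j) → O → ℝ} (hW : ∀ z c, W z c ∈ stdSimplex ℝ O)
    (H : ∀ j, C j → Z → C (!j) → O → Prop) {β δ : Bool → ℝ}
    (hβ : ∀ j z c' o, ∑ c, pC j c * ind (H j c z c' o) ≤ β j)
    (hδ : ∀ j, ∑ z, ∑ c : ∀ i, C i, ∑ o, μ z * (∏ i, pC i (c i)) * W z c o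
      * ind (¬H j (c j) z (c (!j)) o) ≤ δ j) :
    ∃ (z : Z) (f : ∀ j, ι j → C j),
      ∑ s, P s * ∑ o, W z (fun j => f j (k j (s j))) o * ∑ j,
          ind (¬H j (f j (k j (s j))) z (f (!j) (k (!j) (s (!j)))) o ∨
            ∃ m, m ≠ k j (s j) ∧ cand j m (s (!j)) ∧ H j (f j m) z (f (!j) (k (!j) (s (!j)))) o)
        ≤ ∑ j, (δ j + β j * ∑ s, P s * ∑ m, ind (cand j m (s (!j)))) := by
  classical
  set w : (∀ x : (Σ j, ι j), C x.1) → ℝ := fun f => ∏ x, pC x.1 (f x) with hw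
  have hwS : w ∈ stdSimplex ℝ (∀ x : (Σ j, ι j), C x.1) :=
    prod_mem_stdSimplex fun x : (Σ j, ι j) => hpC x.1
  set E : (∀ j, A j) → Bool → Z → (∀ x : (Σ j, ι j), C x.1) → ℝ := fun s j z f =>
    ∑ o, W z (fun j => f ⟨j, k j (s j)⟩) o *
      ind (¬H j (f ⟨j, k j (s j)⟩) z (f ⟨!j, k (!j) (s (!j))⟩) o ∨
        ∃ m, m ≠ k j (s j) ∧ cand j m (s (!j)) ∧ H j (f ⟨j, m⟩) z (f ⟨!j, k (!j) (s (!j))⟩) o) with hE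
  have key : ∀ s j, ∑ z, μ z * ∑ f, w f * E s j z f ≤ δ j + β j * ∑ m, ind (cand j m (s (!j))) := by
    intro s j
    have h1 : ∀ z f, E s j z f
        ≤ (∑ o, W z (fun j => f ⟨j, k j (s j)⟩) o *
              ind (¬H j (f ⟨j, k j (s j)⟩) z (f ⟨!j, k (!j) (s (!j))⟩) o))
          + ∑ m, ind (m ≠ k j (s j) ∧ cand j m (s (!j))) *
            ∑ o, W z (fun j => f ⟨j, k j (s j)⟩) o * ind (H j (f ⟨j, m⟩) z (f ⟨!j, k (!j) (s (!j))⟩) o) := by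
      intro z f
      have : ∀ o, ind (¬H j (f ⟨j, k j (s j)⟩) z (f ⟨!j, k (!j) (s (!j))⟩) o ∨
          ∃ m, m ≠ k j (s j) ∧ cand j m (s (!j)) ∧ H j (f ⟨j, m⟩) z (f ⟨!j, k (!j) (s (!j))⟩) o)
          ≤ ind (¬H j (f ⟨j, k j (s j)⟩) z (f ⟨!j, k (!j) (s (!j))⟩) o)
            + ∑ m, ind (m ≠ k j (s j) ∧ cand j m (s (!j))) *
              ind (H j (f ⟨j, m⟩) z (f ⟨!j, k (!j) (s (!j))⟩) o) := by
        intro o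
        refine (ind_or_le _ _).trans (add_le_add le_rfl ((ind_exists_le _).trans (le_of_eq ?_)))
        exact Finset.sum_congr rfl fun m _ => by rw [← ind_and, and_assoc]
      refine (Finset.sum_le_sum fun o _ => mul_le_mul_of_nonneg_left (this o) ((hW z _).1 o)).trans
        (le_of_eq ?_)
      simp only [mul_add, Finset.sum_add_distrib, Finset.mul_sum]
      congr 1
      rw [Finset.sum_comm]
      exact Finset.sum_congr rfl fun m _ => Finset.sum_congr rfl fun o _ => by ring
    have h2 : ∑ z, μ z * ∑ f, w f * ∑ o, W z (fun j => f ⟨j, k j (s j)⟩) o *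
              ind (¬H j (f ⟨j, k j (s j)⟩) z (f ⟨!j, k (!j) (s (!j))⟩) o) ≤ δ j := by
      refine le_trans (le_of_eq ?_) (hδ j)
      refine Finset.sum_congr rfl fun z _ => ?_
      rw [hw, sum_prod_mul_comp_section (fun j => (hpC j).2) (fun j => k j (s j))
        fun c => ∑ o, W z c o * ind (¬H j (c j) z (c (!j)) o)]
      simp only [Finset.mul_sum]
      exact Finset.sum_congr rfl fun c _ => Finset.sum_congr rfl fun o _ => by ring
    -- A wrong codeword is independent of the two sent codewords, hence of the output, so it may be
    -- redrawn and `hβ` applies.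
    have h3 : ∀ z m, m ≠ k j (s j) → ∑ f, w f *
        ∑ o, W z (fun j => f ⟨j, k j (s j)⟩) o * ind (H j (f ⟨j, m⟩) z (f ⟨!j, k (!j) (s (!j))⟩) o)
          ≤ β j := by
      intro z m hm
      rw [hw, sum_prod_mul_resample (fun x : (Σ j, ι j) => pC x.1) ⟨j, m⟩ (hpC j).2]
      have hne : ∀ i, (⟨i, k i (s i)⟩ : Σ j, ι j) ≠ ⟨j, m⟩ := by
        intro i h
        obtain rfl : i = j := congrArg Sigma.fst h
        exact hm (eq_of_heq (Sigma.mk.inj h).2).symm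
      have hup : ∀ (f : ∀ x : (Σ j, ι j), C x.1) (a : C j) i,
          Function.update f ⟨j, m⟩ a ⟨i, k i (s i)⟩ = f ⟨i, k i (s i)⟩ := fun f a i =>
        Function.update_of_ne (hne i) _ _
      simp only [hup, Function.update_self]
      calc _ ≤ ∑ f, w f * β j := by
            refine Finset.sum_le_sum fun f _ => mul_le_mul_of_nonneg_left ?_ (hwS.1 f)
            calc _ = ∑ o, W z (fun j => f ⟨j, k j (s j)⟩) o *
                    ∑ a, pC j a * ind (H j a z (f ⟨!j, k (!j) (s (!j))⟩) o) := by
                  simp only [Finset.mul_sum]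
                  rw [Finset.sum_comm]
                  exact Finset.sum_congr rfl fun o _ => Finset.sum_congr rfl fun a _ => by ring
              _ ≤ ∑ o, W z (fun j => f ⟨j, k j (s j)⟩) o * β j :=
                  Finset.sum_le_sum fun o _ => mul_le_mul_of_nonneg_left (hβ _ _ _ _) ((hW z _).1 o)
              _ = β j := by rw [← Finset.sum_mul, (hW z _).2, one_mul]
        _ = β j := by rw [← Finset.sum_mul, hwS.2, one_mul]
    calc _ ≤ ∑ z, μ z * ∑ f, w f * ((∑ o, W z (fun j => f ⟨j, k j (s j)⟩) o *
              ind (¬H j (f ⟨j, k j (s j)⟩) z (f ⟨!j, k (!j) (s (!j))⟩) o))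
          + ∑ m, ind (m ≠ k j (s j) ∧ cand j m (s (!j))) *
            ∑ o, W z (fun j => f ⟨j, k j (s j)⟩) o * ind (H j (f ⟨j, m⟩) z (f ⟨!j, k (!j) (s (!j))⟩) o)) := by
          gcongr with z _ f _
          · exact hμ.1 z
          · exact hwS.1 f
          · exact h1 z f
      _ = (∑ z, μ z * ∑ f, w f * ∑ o, W z (fun j => f ⟨j, k j (s j)⟩) o *
              ind (¬H j (f ⟨j, k j (s j)⟩) z (f ⟨!j, k (!j) (s (!j))⟩) o))
          + ∑ z, μ z * ∑ m, ind (m ≠ k j (s j) ∧ cand j m (s (!j))) * ∑ f, w f *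
            ∑ o, W z (fun j => f ⟨j, k j (s j)⟩) o * ind (H j (f ⟨j, m⟩) z (f ⟨!j, k (!j) (s (!j))⟩) o) := by
          simp only [mul_add, Finset.sum_add_distrib]
          congr 1
          refine Finset.sum_congr rfl fun z _ => ?_
          congr 1
          simp only [Finset.mul_sum]
          rw [Finset.sum_comm]
          exact Finset.sum_congr rfl fun m _ => Finset.sum_congr rfl fun f _ =>
            Finset.sum_congr rfl fun o _ => by ring
      _ ≤ δ j + ∑ z, μ z * ∑ m, ind (cand j m (s (!j))) * β j := by
          refine add_le_add h2 (Finset.sum_le_sum fun z _ => mul_le_mul_of_nonneg_left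
            (Finset.sum_le_sum fun m _ => ?_) (hμ.1 z))
          by_cases hm : m ≠ k j (s j)
          · exact mul_le_mul (ind_le_ind fun h => h.2) (h3 z m hm)
              (Finset.sum_nonneg fun f _ => mul_nonneg (hwS.1 f) (Finset.sum_nonneg fun o _ =>
                mul_nonneg ((hW z _).1 o) (ind_nonneg _))) (ind_nonneg _)
          -- The true index contributes zero on the left, so only `0 ≤ β j` is needed; it follows
          -- from `hβ` at any point, and the points come from the probability laws.
          · rw [ind_of_not fun h => hm h.1, zero_mul]
            refine mul_nonneg (ind_nonneg _) ?_
            obtain ⟨f, -⟩ := exists_le_of_sum_mul_le (f := fun _ => (0 : ℝ)) (c := 0) hwS (by simp)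
            obtain ⟨o, -⟩ := exists_le_of_sum_mul_le (f := fun _ => (0 : ℝ)) (c := 0)
              (hW z fun i => f ⟨i, k i (s i)⟩) (by simp)
            exact le_trans (Finset.sum_nonneg fun c _ => mul_nonneg ((hpC j).1 c) (ind_nonneg _))
              (hβ j z (f ⟨!j, k (!j) (s (!j))⟩) o)
      _ = _ := by
          rw [← Finset.sum_mul, hμ.2, one_mul, ← Finset.sum_mul, mul_comm (β j)]
  -- `z` and the codebook are drawn together, and the errors of both directions are summed before
  -- averaging, so a single realisation serves both terminals.
  have hprod : (fun x : Z × (∀ x : (Σ j, ι j), C x.1) => μ x.1 * w x.2) ∈ stdSimplex ℝ _ := by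
    refine ⟨fun x => mul_nonneg (hμ.1 _) (hwS.1 _), ?_⟩
    rw [Fintype.sum_prod_type]
    simp only [← Finset.mul_sum, hwS.2, mul_one, hμ.2]
  obtain ⟨⟨z, f⟩, hzf⟩ := exists_le_of_sum_mul_le hprod
    (f := fun x => ∑ s, P s * ∑ j, E s j x.1 x.2)
    (c := ∑ j, (δ j + β j * ∑ s, P s * ∑ m, ind (cand j m (s (!j))))) (by
      rw [Fintype.sum_prod_type]
      calc _ = ∑ j, ∑ s, P s * ∑ z, μ z * ∑ f, w f * E s j z f := by
            simp only [Finset.mul_sum]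
            rw [Finset.sum_comm (s := (Finset.univ : Finset Bool))]
            calc _ = ∑ z, ∑ s, ∑ f, ∑ j, μ z * w f * (P s * E s j z f) :=
                  Finset.sum_congr rfl fun z _ => Finset.sum_comm
              _ = ∑ s, ∑ z, ∑ f, ∑ j, μ z * w f * (P s * E s j z f) := Finset.sum_comm
              _ = ∑ s, ∑ z, ∑ j, ∑ f, μ z * w f * (P s * E s j z f) :=
                  Finset.sum_congr rfl fun s _ => Finset.sum_congr rfl fun z _ => Finset.sum_comm
              _ = ∑ s, ∑ j, ∑ z, ∑ f, μ z * w f * (P s * E s j z f) :=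
                  Finset.sum_congr rfl fun s _ => Finset.sum_comm
              _ = _ := by
                  refine Finset.sum_congr rfl fun s _ => Finset.sum_congr rfl fun j _ =>
                    Finset.sum_congr rfl fun z _ => Finset.sum_congr rfl fun f _ => by ring
        _ ≤ ∑ j, ∑ s, P s * (δ j + β j * ∑ m, ind (cand j m (s (!j)))) :=
            Finset.sum_le_sum fun j _ => Finset.sum_le_sum fun s _ =>
              mul_le_mul_of_nonneg_left (key s j) (hP.1 s)
        _ = _ := by
            refine Finset.sum_congr rfl fun j _ => ?_
            simp only [mul_add, Finset.sum_add_distrib]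
            rw [← Finset.sum_mul, hP.2, one_mul, Finset.mul_sum]
            congr 1
            exact Finset.sum_congr rfl fun s _ => by ring)
  refine ⟨z, fun j m => f ⟨j, m⟩, le_trans (le_of_eq ?_) hzf⟩
  refine Finset.sum_congr rfl fun s _ => ?_
  congr 1
  simp only [hE, Finset.mul_sum]
  rw [Finset.sum_comm]

end ChannelCodebook

/-! ### Trajectories of driven chains -/

section Trajectory

variable {σ ε : Type*}

/-- The first `L` states visited from the state `s` under the inputs `e`. -/
def traj (next : σ → ε → σ) : (L : ℕ) → σ → (Fin L → ε) → Fin L → σ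
  | 0, _, _ => Fin.elim0
  | L + 1, s, e => Fin.cons s (traj next L (next s (e 0)) fun i => e i.succ)

@[simp]
lemma traj_zero (next : σ → ε → σ) (L : ℕ) (s : σ) (e : Fin (L + 1) → ε) :
    traj next (L + 1) s e 0 = s := rfl

@[simp]
lemma traj_succ (next : σ → ε → σ) (L : ℕ) (s : σ) (e : Fin (L + 1) → ε) (b : Fin L) :
    traj next (L + 1) s e b.succ = traj next L (next s (e 0)) (fun i => e i.succ) b := rfl

lemma traj_succ_eq_next (next : σ → ε → σ) (L : ℕ) (s : σ) (e : Fin (L + 1) → ε) (b : Fin L) :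
    traj next (L + 1) s e b.succ = next (traj next (L + 1) s e b.castSucc) (e b.castSucc) := by
  induction L generalizing s with
  | zero => exact b.elim0
  | succ L ih =>
    refine Fin.cases ?_ (fun b => ?_) b
    · rfl
    · rw [traj_succ, ih, Fin.castSucc_succ, traj_succ]

/-- Causality: this is what makes the adaptive encoders realisable from past outputs alone. -/
lemma traj_congr (next : σ → ε → σ) (L : ℕ) (s : σ) {e e' : Fin L → ε} (b : Fin L)
    (h : ∀ i < b, e i = e' i) : traj next L s e b = traj next L s e' b := by
  induction L generalizing s with
  | zero => exact b.elim0
  | succ L ih =>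
    induction b using Fin.cases with
    | zero => rfl
    | succ b =>
      rw [traj_succ, traj_succ, h 0 (Fin.succ_pos b)]
      exact ih _ b fun i hi => h i.succ (Fin.succ_lt_succ_iff.2 hi)

/-- Used to restrict the joint memory to that of one terminal. -/
lemma map_traj {σ' ε' : Type*} {next : σ → ε → σ} {next' : σ' → ε' → σ'} (π : σ → σ') (ρ : ε → ε')
    (h : ∀ s e, π (next s e) = next' (π s) (ρ e)) (L : ℕ) (s : σ) (e : Fin L → ε) (b : Fin L) :
    π (traj next L s e b) = traj next' L (π s) (fun i => ρ (e i)) b := by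
  induction L generalizing s with
  | zero => exact b.elim0
  | succ L ih =>
    induction b using Fin.cases with
    | zero => rfl
    | succ b => rw [traj_succ, traj_succ, ih, h]

variable [Fintype ε]

/-- The probability of the inputs `e` when the next input has law `step s` in the state `s`. -/
def pathWeight (next : σ → ε → σ) (step : σ → ε → ℝ) (L : ℕ) (s : σ) (e : Fin L → ε) : ℝ :=
  ∏ b, step (traj next L s e b) (e b)

omit [Fintype ε] in
lemma pathWeight_succ (next : σ → ε → σ) (step : σ → ε → ℝ) (L : ℕ) (s : σ) (x : ε) (e : Fin L → ε) :
    pathWeight next step (L + 1) s (Fin.cons x e) = step s x * pathWeight next step L (next s x) e := by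
  simp [pathWeight, Fin.prod_univ_succ]

lemma sum_cons (L : ℕ) (F : (Fin (L + 1) → ε) → ℝ) :
    ∑ e, F e = ∑ x : ε, ∑ e : Fin L → ε, F (Fin.cons x e) := by
  rw [← (Fin.consEquiv fun _ : Fin (L + 1) => ε).sum_comp, Fintype.sum_prod_type]
  rfl

lemma pathWeight_mem {next : σ → ε → σ} {step : σ → ε → ℝ} (hstep : ∀ s, step s ∈ stdSimplex ℝ ε)
    (L : ℕ) (s : σ) : pathWeight next step L s ∈ stdSimplex ℝ (Fin L → ε) := by
  refine ⟨fun e => Finset.prod_nonneg fun b _ => (hstep _).1 _, ?_⟩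
  induction L generalizing s with
  | zero => simp [pathWeight]
  | succ L ih =>
    rw [sum_cons]
    simp only [pathWeight_succ, ← Finset.mul_sum, ih, mul_one]
    exact (hstep s).2

/-- Along a stationary chain, every state has the stationary law. -/
lemma sum_pathWeight_mul [Fintype σ] {next : σ → ε → σ} {step : σ → ε → ℝ}
    (hstep : ∀ s, step s ∈ stdSimplex ℝ ε) {μ : σ → ℝ}
    (hμ : ∀ F : σ → ℝ, ∑ s, μ s * ∑ x, step s x * F (next s x) = ∑ s, μ s * F s)
    (L : ℕ) (f : Fin L → σ → ε → ℝ) :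
    ∑ s, μ s * ∑ e, pathWeight next step L s e * ∑ b, f b (traj next L s e b) (e b)
      = ∑ b, ∑ s, μ s * ∑ x, step s x * f b s x := by
  induction L with
  | zero => simp
  | succ L ih =>
    have h : ∀ s, ∑ e, pathWeight next step (L + 1) s e * ∑ b, f b (traj next (L + 1) s e b) (e b)
        = ∑ x, step s x * f 0 s x + ∑ x, step s x * ∑ e, pathWeight next step L (next s x) e *
            ∑ b, f (Fin.succ b) (traj next L (next s x) e b) (e b) := by
      intro s
      rw [sum_cons, ← Finset.sum_add_distrib]
      refine Finset.sum_congr rfl fun x _ => ?_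
      simp only [pathWeight_succ, Fin.sum_univ_succ, traj_zero, traj_succ, Fin.cons_zero, Fin.cons_succ,
        mul_add, Finset.sum_add_distrib]
      congr 1
      · rw [← Finset.sum_mul, ← Finset.mul_sum, (pathWeight_mem hstep L (next s x)).2, mul_one]
      · rw [Finset.mul_sum]
        exact Finset.sum_congr rfl fun e _ => by ring
    rw [Finset.sum_congr rfl fun s _ => congrArg (μ s * ·) (h s), Fin.sum_univ_succ]
    simp only [mul_add, Finset.sum_add_distrib]
    congr 1
    -- By stationarity the state after the first step again has law μ, so the induction hypothesis
    -- covers the remaining steps.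
    rw [hμ fun s => ∑ e, pathWeight next step L s e *
      ∑ b, f (Fin.succ b) (traj next L s e b) (e b), ih]

end Trajectory

/-! ### Wyner-Ziv source coding -/

section SourceCoding

lemma sum_pi_comm {κ J : Type*} [Fintype κ] [DecidableEq κ] [Fintype J] [DecidableEq J] {S : J → Type*}
    [∀ j, Fintype (S j)] (F : (∀ j, κ → S j) → ℝ) :
    ∑ s, F s = ∑ s : κ → ∀ j, S j, F fun j k => s k j :=
  ((Equiv.piComm fun (_ : κ) j => S j).sum_comp F).symm

lemma sum_pi_prod {κ : Type*} [Fintype κ] [DecidableEq κ] {α β : κ → Type*} [∀ k, Fintype (α k)]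
    [∀ k, Fintype (β k)] (F : (∀ k, α k × β k) → ℝ) :
    ∑ x, F x = ∑ a : ∀ k, α k, ∑ b : ∀ k, β k, F fun k => (a k, b k) := by
  rw [← (Equiv.arrowProdEquivProdArrow κ α β).symm.sum_comp, Fintype.sum_prod_type]
  rfl

variable {S Shat X Y : Bool → Type*}
  [∀ j, Fintype (S j)] [∀ j, Fintype (Shat j)] [∀ j, Fintype (X j)] [∀ j, Fintype (Y j)]
  {T : Type*} [Fintype T] (sys : System S Shat X Y) {j : Bool} {p : S j → T → ℝ}

namespace System

lemma wzLaw_mem (hp : ∀ s, p s ∈ stdSimplex ℝ T) :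
    sys.wzLaw j p ∈ stdSimplex ℝ ((∀ i, S i) × T) := by
  refine ⟨fun ω => mul_nonneg (sys.src_mem.1 _) ((hp _).1 _), ?_⟩
  rw [Fintype.sum_prod_type]
  simp only [wzLaw, ← Finset.mul_sum, (hp _).2, mul_one, sys.src_mem.2]

omit [Fintype T] in
lemma wzLaw_pos {ω : (∀ i, S i) × T} (h : 0 < sys.wzLaw j p ω) :
    0 < p (ω.1 j) ω.2 :=
  pos_of_mul_pos_right h (sys.src_mem.1 _)

/-- Gibbs' inequality for the Wyner-Ziv law. -/
lemma wzLaw_gibbs (hp : ∀ s, p s ∈ stdSimplex ℝ T) {v : (∀ i, S i) → T → ℝ} (hv0 : ∀ s t, 0 ≤ v s t)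
    (hv1 : ∀ s, ∑ t, v s t ≤ 1) (hpos : ∀ ω, 0 < sys.wzLaw j p ω → 0 < v ω.1 ω.2) :
    0 ≤ ∑ ω, sys.wzLaw j p ω * (Real.log (p (ω.1 j) ω.2) - Real.log (v ω.1 ω.2)) := by
  have h1 : ∀ ω, sys.wzLaw j p ω - sys.src ω.1 * v ω.1 ω.2
      ≤ sys.wzLaw j p ω * (Real.log (p (ω.1 j) ω.2) - Real.log (v ω.1 ω.2)) := by
    intro ω
    rcases ((sys.wzLaw_mem hp).1 ω).eq_or_lt with h | h
    · rw [← h, zero_mul]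
      linarith [mul_nonneg (sys.src_mem.1 ω.1) (hv0 ω.1 ω.2)]
    · have hp' := sys.wzLaw_pos h
      have hl := Real.log_le_sub_one_of_pos (div_pos (hpos ω h) hp')
      rw [Real.log_div (hpos ω h).ne' hp'.ne'] at hl
      have : sys.wzLaw j p ω - sys.src ω.1 * v ω.1 ω.2
          = sys.wzLaw j p ω * (1 - v ω.1 ω.2 / p (ω.1 j) ω.2) := by
        rw [wzLaw]
        field_simp
      rw [this]
      exact mul_le_mul_of_nonneg_left (by linarith) h.le
  refine le_trans ?_ (Finset.sum_le_sum fun ω _ => h1 ω)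
  rw [Finset.sum_sub_distrib, (sys.wzLaw_mem hp).2, sub_nonneg, Fintype.sum_prod_type, ← sys.src_mem.2]
  simp only [← Finset.mul_sum]
  exact Finset.sum_le_sum fun s _ => mul_le_of_le_one_right (sys.src_mem.1 s) (hv1 s)

/-- By the Markov condition, the law of `T` given both sources is `p` itself, which is the
factorisation `hfac`. -/
lemma wzInfo_eq (hp : ∀ s, p s ∈ stdSimplex ℝ T) :
    sys.wzInfo j p = ∑ ω, sys.wzLaw j p ω * (Real.log (p (ω.1 j) ω.2)
      - Real.log (condLaw (sys.wzLaw j p) (fun ω => ω.2) (fun ω => ω.1 (!j)) (ω.1 (!j)) ω.2)) := by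
  set P := sys.wzLaw j p with hP
  have hP0 : ∀ ω, 0 ≤ P ω := (sys.wzLaw_mem hp).1
  have hfac : ∀ a t c, law P (fun ω => (ω.1 j, ω.2, ω.1 (!j))) (a, t, c)
      = p a t * law P (fun ω => (ω.1 j, ω.1 (!j))) (a, c) := by
    intro a t c
    classical
    simp only [law_eq, Fintype.sum_prod_type, Finset.mul_sum]
    refine Finset.sum_congr rfl fun s _ => ?_
    by_cases h : s j = a ∧ s (!j) = c
    · obtain ⟨rfl, rfl⟩ := h
      rw [Finset.sum_eq_single t]
      · rw [ind_of rfl]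
        simp only [hP, wzLaw, ind_of, mul_one, ← Finset.mul_sum, (hp _).2]
        ring
      · intro t' _ ht'
        rw [ind_of_not (by simp [ht']), mul_zero]
      · simp
    · rw [Finset.sum_eq_zero, Finset.sum_eq_zero]
      · intro t' _
        rw [ind_of_not (by simpa using h)]; simp
      · intro t' _
        rw [ind_of_not (fun h' => h (by simp only [Prod.mk.injEq] at h'; exact ⟨h'.1, h'.2.2⟩)), mul_zero]
  rw [wzInfo, ← hP, condMutualInfo, entropy_eq, entropy_eq, entropy_eq, entropy_eq, ← Finset.sum_neg_distrib,
    ← Finset.sum_neg_distrib, ← Finset.sum_neg_distrib, ← Finset.sum_neg_distrib, ← Finset.sum_add_distrib,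
    ← Finset.sum_sub_distrib, ← Finset.sum_sub_distrib]
  refine Finset.sum_congr rfl fun ω _ => ?_
  rcases (hP0 ω).eq_or_lt with h | h
  · simp [← h]
  · rw [hfac, condLaw,
      Real.log_div (law_pos hP0 (fun ω => (ω.2, ω.1 (!j))) h).ne' (law_pos hP0 (fun ω => ω.1 (!j)) h).ne',
      Real.log_mul (sys.wzLaw_pos h).ne' (law_pos hP0 (fun ω => (ω.1 j, ω.1 (!j))) h).ne']
    ring

lemma wzInfo_nonneg (hp : ∀ s, p s ∈ stdSimplex ℝ T) : 0 ≤ sys.wzInfo j p := by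
  rw [sys.wzInfo_eq hp]
  have h0 := (sys.wzLaw_mem hp).1
  exact sys.wzLaw_gibbs hp
    (v := fun s t => condLaw (sys.wzLaw j p) (fun ω => ω.2) (fun ω => ω.1 (!j)) (s (!j)) t)
    (fun s t => condLaw_nonneg h0 _ _ _ _) (fun s => sum_condLaw_le_one _ _ _ _)
    (fun ω h => condLaw_pos h0 (fun ω => ω.2) (fun ω => ω.1 (!j)) h)

/-- The distribution of a pair of source blocks. -/
def srcBlock (K : ℕ) (s : ∀ j, Fin K → S j) : ℝ := ∏ k, sys.src fun j => s j k

lemma srcBlock_mem (K : ℕ) : sys.srcBlock K ∈ stdSimplex ℝ (∀ j, Fin K → S j) := by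
  refine ⟨fun s => Finset.prod_nonneg fun k _ => sys.src_mem.1 _, ?_⟩
  rw [sum_pi_comm]
  exact (prod_mem_stdSimplex fun _ : Fin K => sys.src_mem).2

/-- Tail bound for an i.i.d. sequence drawn from the Wyner-Ziv law. -/
lemma exists_wz_tail (hp : ∀ s, p s ∈ stdSimplex ℝ T) {u v : (∀ i, S i) × T → ℝ}
    (hu : ∀ ω, 0 < sys.wzLaw j p ω → 0 < u ω) (hv : ∀ ω, 0 < sys.wzLaw j p ω → 0 < v ω) {c : ℝ}
    (h : ∑ ω, sys.wzLaw j p ω * (Real.log (u ω) - Real.log (v ω)) < c) :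
    ∃ ρ : ℝ, 0 ≤ ρ ∧ ρ < 1 ∧ ∀ K : ℕ,
      ∑ s : ∀ i, Fin K → S i, ∑ t : Fin K → T, sys.srcBlock K s * (∏ k, p (s j k) (t k)) *
        ind (¬ ∏ k, u (fun i => s i k, t k) ≤ Real.exp (K * c) * ∏ k, v (fun i => s i k, t k)) ≤ ρ ^ K := by
  obtain ⟨ρ, h0, h1, hρ⟩ := exists_pow_bound_prod (sys.wzLaw_mem hp) hu hv h
  refine ⟨ρ, h0, h1, fun K => le_trans (le_of_eq ?_) (hρ K)⟩
  rw [sum_pi_comm, sum_pi_prod]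
  refine Finset.sum_congr rfl fun s _ => Finset.sum_congr rfl fun t _ => ?_
  simp only [wzLaw, Finset.prod_mul_distrib, srcBlock]

/-- Wyner-Ziv coding: the good codeword for a source block exists, and a codeword compatible with the side
information survives a further random test of exponent `r > I(S_j; T_j | S_{j'})` only rarely. -/
lemma exists_wz_codebook (hp : ∀ s, p s ∈ stdSimplex ℝ T) (h : T → S (!j) → Shat j) {D r ε : ℝ}
    (hD : sys.wzDistortion j p h ≤ D) (hr : sys.wzInfo j p < r) (hε : 0 < ε) :
    ∀ᶠ K : ℕ in atTop, ∃ (M : ℕ) (cb : Fin M → Fin K → T) (k : (Fin K → S j) → Fin M)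
      (cmp : (Fin K → T) → (Fin K → S (!j)) → Prop),
      ∑ s, sys.srcBlock K s * (ind (¬(cmp (cb (k (s j))) (s (!j)) ∧
          ∑ i, sys.dist j (s j i) (h (cb (k (s j)) i) (s (!j) i)) ≤ K * (D + ε)))
        + Real.exp (-(K * r)) * ∑ m, ind (cmp (cb m) (s (!j)))) ≤ ε := by
  classical
  set P := sys.wzLaw j p with hPdef
  have hP := sys.wzLaw_mem hp
  rw [← hPdef] at hP
  set Q : T → ℝ := law P fun ω => ω.2 with hQdef
  have hQ : Q ∈ stdSimplex ℝ T := law_mem_stdSimplex hP _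
  set R : S (!j) → T → ℝ := condLaw P (fun ω => ω.2) (fun ω => ω.1 (!j)) with hR
  have hQpos : ∀ ω, 0 < P ω → 0 < Q ω.2 := fun ω hω => law_pos hP.1 (fun ω => ω.2) hω
  have hRpos : ∀ ω, 0 < P ω → 0 < R (ω.1 (!j)) ω.2 := fun ω hω =>
    condLaw_pos hP.1 (fun ω => ω.2) (fun ω => ω.1 (!j)) hω
  have hppos : ∀ ω, 0 < P ω → 0 < p (ω.1 j) ω.2 := fun ω hω => sys.wzLaw_pos hω
  -- `I₁` is I(S_j;T) and `I₂` is I(S_{j'};T); their difference is the conditional information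
  -- because of the Markov chain.
  set I₁ := ∑ ω, P ω * (Real.log (p (ω.1 j) ω.2) - Real.log (Q ω.2)) with hI₁
  set I₂ := ∑ ω, P ω * (Real.log (R (ω.1 (!j)) ω.2) - Real.log (Q ω.2)) with hI₂
  have hI : sys.wzInfo j p = I₁ - I₂ := by
    rw [sys.wzInfo_eq hp, hI₁, hI₂, ← Finset.sum_sub_distrib]
    exact Finset.sum_congr rfl fun ω _ => by ring
  have hI₁0 : 0 ≤ I₁ := sys.wzLaw_gibbs hp (v := fun _ t => Q t) (fun _ t => hQ.1 t)
    (fun _ => hQ.2.le) hQpos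
  -- Of the three δ, two are spent on the codebook size and one on the compatibility test; δ ≤ ε
  -- covers the distortion slack.
  obtain ⟨δ, hδ0, hδε, hδr⟩ : ∃ δ : ℝ, 0 < δ ∧ δ ≤ ε ∧ 0 < r - sys.wzInfo j p - 3 * δ :=
    ⟨min ε ((r - sys.wzInfo j p) / 4), lt_min hε (by linarith), min_le_left _ _, by
      have := min_le_right ε ((r - sys.wzInfo j p) / 4); linarith⟩
  obtain ⟨ρ₁, h10, h11, h1⟩ := sys.exists_wz_tail hp (u := fun ω => p (ω.1 j) ω.2) (v := fun ω => Q ω.2)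
    hppos hQpos (c := I₁ + δ) (by linarith)
  obtain ⟨ρ₂, h20, h21, h2⟩ := sys.exists_wz_tail hp (u := fun ω => Q ω.2)
    (v := fun ω => R (ω.1 (!j)) ω.2) hQpos hRpos (c := δ - I₂) (by
      have : ∑ ω, P ω * (Real.log (Q ω.2) - Real.log (R (ω.1 (!j)) ω.2)) = - I₂ := by
        rw [hI₂, ← Finset.sum_neg_distrib]
        exact Finset.sum_congr rfl fun ω _ => by ring
      linarith)
  -- The total distortion is the logarithm of a product of exponentials, so the likelihood-ratio
  -- tail bound applies to it as well.
  obtain ⟨ρ₃, h30, h31, h3⟩ := sys.exists_wz_tail hp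
    (u := fun ω => Real.exp (sys.dist j (ω.1 j) (h ω.2 (ω.1 (!j))))) (v := fun _ => 1)
    (fun _ _ => Real.exp_pos _) (fun _ _ => one_pos) (c := D + δ) (by
      simp only [Real.log_exp, Real.log_one, sub_zero]
      exact lt_of_le_of_lt hD (by linarith))
  set η : ℝ := min (ε / 4) (1 / 2) with hη
  have hη0 : 0 < η := lt_min (by linarith) (by norm_num)
  -- This exceeds γ = exp(K(I₁ + δ)) by a factor exp(Kδ), so the covering error exp(-M/γ) is doubly
  -- exponentially small. Since I₁ ≥ 0, rounding up at most doubles the size.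
  set M : ℕ → ℕ := fun K => ⌈Real.exp (K * (I₁ + 2 * δ))⌉₊ with hM
  have hM1 : ∀ K : ℕ, Real.exp (K * (I₁ + 2 * δ)) ≤ M K := fun K => Nat.le_ceil _
  have hM2 : ∀ K : ℕ, (M K : ℝ) ≤ 2 * Real.exp (K * (I₁ + 2 * δ)) := fun K => by
    have := (Nat.ceil_lt_add_one (Real.exp_pos (K * (I₁ + 2 * δ))).le).le
    have h' : (1 : ℝ) ≤ Real.exp (K * (I₁ + 2 * δ)) := Real.one_le_exp (by positivity)
    linarith
  have hlim1 : Tendsto (fun K : ℕ => (ρ₁ ^ K + ρ₂ ^ K + ρ₃ ^ K) / η) atTop (𝓝 0) := by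
    have := (((tendsto_pow_atTop_nhds_zero_of_lt_one h10 h11).add
      (tendsto_pow_atTop_nhds_zero_of_lt_one h20 h21)).add
      (tendsto_pow_atTop_nhds_zero_of_lt_one h30 h31)).div_const η
    simpa using this
  have hexp : ∀ x : ℝ, 0 < x → Tendsto (fun K : ℕ => Real.exp (-(K * x))) atTop (𝓝 0) := fun x hx =>
    Real.tendsto_exp_neg_atTop_nhds_zero.comp (tendsto_natCast_atTop_atTop.atTop_mul_const hx)
  have hlim2 : Tendsto (fun K : ℕ => Real.exp (-Real.exp (K * δ))) atTop (𝓝 0) :=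
    Real.tendsto_exp_neg_atTop_nhds_zero.comp
      (Real.tendsto_exp_atTop.comp (tendsto_natCast_atTop_atTop.atTop_mul_const hδ0))
  have hlim3 : Tendsto (fun K : ℕ => 2 * Real.exp (-(K * (r - sys.wzInfo j p - 3 * δ)))) atTop (𝓝 0) := by
    simpa using (hexp _ hδr).const_mul 2
  have hε4 : 0 < ε / 4 := by linarith
  filter_upwards [hlim1.eventually (gt_mem_nhds hε4), hlim2.eventually (gt_mem_nhds hε4),
    hlim3.eventually (gt_mem_nhds hε4)] with K e1 e2 e3
  set cmp : (Fin K → T) → (Fin K → S (!j)) → Prop := fun t y =>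
    ∏ k, Q (t k) ≤ Real.exp (K * (δ - I₂)) * ∏ k, R (y k) (t k) with hcmp
  obtain ⟨cb, k, hcb⟩ := exists_source_codebook (sys.srcBlock_mem K) (fun s => s j) (fun s => s (!j))
    (p := fun x t => ∏ k, p (x k) (t k)) (Q := fun t => ∏ k, Q (t k))
    (fun x => prod_mem_stdSimplex fun k => hp (x k)) (prod_mem_stdSimplex fun _ : Fin K => hQ)
    (fun x t y => ∏ k, p (x k) (t k) ≤ Real.exp (K * (I₁ + δ)) * ∏ k, Q (t k) ∧ cmp t y ∧
      ∑ i, sys.dist j (x i) (h (t i) (y i)) ≤ K * (D + δ)) cmp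
    (γ := Real.exp (K * (I₁ + δ))) (β := Real.exp (K * (δ - I₂))) (δ := ρ₁ ^ K + ρ₂ ^ K + ρ₃ ^ K)
    (η := η) (c := Real.exp (-(K * r))) (Real.exp_pos _) (fun x t y hG => hG.1) (fun y => by
      calc _ ≤ ∑ t : Fin K → T, Real.exp (K * (δ - I₂)) * ∏ k, R (y k) (t k) := by
            refine Finset.sum_le_sum fun t _ => ?_
            by_cases hc : cmp t y
            · rw [ind_of hc, mul_one]; exact hc
            · rw [ind_of_not hc, mul_zero]
              exact mul_nonneg (Real.exp_pos _).le
                (Finset.prod_nonneg fun k _ => condLaw_nonneg hP.1 _ _ _ _)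
        _ = Real.exp (K * (δ - I₂)) * ∏ k, ∑ t, R (y k) t := by
            rw [← Finset.mul_sum, Fintype.prod_sum]
        _ ≤ Real.exp (K * (δ - I₂)) * 1 := by
            refine mul_le_mul_of_nonneg_left (Finset.prod_le_one (fun k _ => Finset.sum_nonneg fun t _ =>
              condLaw_nonneg hP.1 _ _ _ _) fun k _ => sum_condLaw_le_one _ _ _ _) (Real.exp_pos _).le
        _ = _ := mul_one _)
    (by
      refine le_trans ?_ (add_le_add (add_le_add (h1 K) (h2 K)) (h3 K))
      rw [← Finset.sum_add_distrib, ← Finset.sum_add_distrib]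
      refine Finset.sum_le_sum fun s _ => ?_
      rw [← Finset.sum_add_distrib, ← Finset.sum_add_distrib]
      refine Finset.sum_le_sum fun t _ => ?_
      rw [← mul_add, ← mul_add]
      refine mul_le_mul_of_nonneg_left ?_ (mul_nonneg ((sys.srcBlock_mem K).1 s)
        (Finset.prod_nonneg fun k _ => (hp _).1 _))
      refine le_trans (ind_le_ind ?_) ((ind_or_le _ _).trans (add_le_add (ind_or_le _ _) le_rfl))
      intro hn
      by_contra! hcon
      obtain ⟨⟨c1, c2⟩, c3⟩ := hcon
      refine hn ⟨c1, c2, ?_⟩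
      rw [← Real.exp_sum, Finset.prod_const_one, mul_one] at c3
      exact Real.exp_le_exp.1 c3)
    hη0 (lt_of_le_of_lt (min_le_right _ _) (by norm_num)) (Real.exp_pos _).le (M K)
    (Nat.ceil_pos.2 (Real.exp_pos _))
  refine ⟨M K, cb, k, cmp, le_trans (Finset.sum_le_sum fun s _ => ?_) (hcb.trans ?_)⟩
  · refine mul_le_mul_of_nonneg_left (add_le_add (ind_le_ind fun hn hG => hn ⟨hG.2.1, hG.2.2.trans ?_⟩)
      le_rfl) ((sys.srcBlock_mem K).1 s)
    gcongr
  · have a1 : Real.exp (-(M K / Real.exp (K * (I₁ + δ)))) ≤ Real.exp (-Real.exp (K * δ)) := by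
      refine Real.exp_le_exp.2 (neg_le_neg ?_)
      rw [le_div_iff₀ (Real.exp_pos _), ← Real.exp_add]
      refine le_trans (le_of_eq ?_) (hM1 K)
      congr 1; ring
    have a2 : Real.exp (-(K * r)) * (M K * Real.exp (K * (δ - I₂)))
        ≤ 2 * Real.exp (-(K * (r - sys.wzInfo j p - 3 * δ))) := by
      calc _ ≤ Real.exp (-(K * r)) * (2 * Real.exp (K * (I₁ + 2 * δ)) * Real.exp (K * (δ - I₂))) := by
            gcongr; exact hM2 K
        _ = 2 * (Real.exp (-(K * r)) * (Real.exp (K * (I₁ + 2 * δ)) * Real.exp (K * (δ - I₂)))) := by ring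
        _ = _ := by
            rw [← Real.exp_add, ← Real.exp_add, hI]
            congr 2; ring
    have a3 : η ≤ ε / 4 := min_le_left _ _
    linarith

end System

end SourceCoding

/-! ### Han's adaptive channel coding -/

/-- The data of Han's adaptive channel coding: the laws of the codeword letters, the conditional law of the
initial channel inputs and outputs, and the adaptive encoders. -/
structure HanScheme (V X Y : Bool → Type*) [∀ j, Fintype (V j)] [∀ j, Fintype (X j)]
    [∀ j, Fintype (Y j)] where
  pV : ∀ j, V j → ℝ
  pV_mem : ∀ j, pV j ∈ stdSimplex ℝ (V j)
  q : (∀ j, V j) → (∀ j, X j × Y j) → ℝ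
  q_mem : ∀ v, q v ∈ stdSimplex ℝ (∀ j, X j × Y j)
  γ : ∀ j, V j → V j → X j × Y j → X j

namespace HanScheme

variable {S Shat V X Y : Bool → Type*}
  [∀ j, Fintype (S j)] [∀ j, Fintype (Shat j)] [∀ j, Fintype (X j)] [∀ j, Fintype (Y j)]
  [∀ j, Fintype (V j)]

/-- The previous codeword letters, channel inputs and channel outputs of both terminals. -/
abbrev HanState (V X Y : Bool → Type*) := ∀ j, V j × (X j × Y j)

/-- The update of the memory of terminal `j` by its codeword letter and its channel output. -/
def ownNext (a : HanScheme V X Y) (j : Bool) (τ : V j × (X j × Y j)) (e : V j × Y j) : V j × (X j × Y j) :=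
  (e.1, (a.γ j e.1 τ.1 τ.2, e.2))

/-- The joint update of the memories of the terminals. -/
def next (a : HanScheme V X Y) (s : HanState V X Y) (e : (∀ j, V j) × (∀ j, Y j)) : HanState V X Y :=
  fun j => a.ownNext j (s j) (e.1 j, e.2 j)

/-- The channel inputs. -/
def input (a : HanScheme V X Y) (s : HanState V X Y) (v : ∀ j, V j) (j : Bool) : X j :=
  a.γ j (v j) (s j).1 (s j).2

/-- The law of the codeword letters and the channel outputs. -/
def step (sys : System S Shat X Y) (a : HanScheme V X Y) (s : HanState V X Y)
    (e : (∀ j, V j) × (∀ j, Y j)) : ℝ :=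
  (∏ j, a.pV j (e.1 j)) * sys.chan (a.input s e.1) e.2

/-- The initial law of the memories. -/
def init (a : HanScheme V X Y) (s : HanState V X Y) : ℝ :=
  (∏ j, a.pV j (s j).1) * a.q (fun j => (s j).1) fun j => (s j).2

/-- The joint law of the memories and of the following codeword letters and channel outputs. -/
def oneStep (sys : System S Shat X Y) (a : HanScheme V X Y)
    (x : HanState V X Y × ((∀ j, V j) × (∀ j, Y j))) : ℝ :=
  a.init x.1 * a.step sys x.1 x.2

/-- What terminal `i` knows: its channel input and output, and its memory. -/
def view (a : HanScheme V X Y) (i : Bool) (τ : V i × (X i × Y i)) (e : V i × Y i) :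
    X i × Y i × V i × (X i × Y i) :=
  (a.γ i e.1 τ.1 τ.2, e.2, τ.1, τ.2)

/-- The initial law of the memories is stationary. -/
def IsStationary (sys : System S Shat X Y) (a : HanScheme V X Y) : Prop :=
  ∀ F : HanState V X Y → ℝ,
    ∑ s, a.init s * ∑ e, a.step sys s e * F (a.next s e) = ∑ s, a.init s * F s

/-- The mutual information between the previous codeword letter of terminal `j` and the view of
terminal `!j`. -/
def rate (sys : System S Shat X Y) (a : HanScheme V X Y) (j : Bool) : ℝ :=
  mutualInfo (a.oneStep sys) (fun x => (x.1 j).1)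
    (fun x => a.view (!j) (x.1 (!j)) (x.2.1 (!j), x.2.2 (!j)))

variable (sys : System S Shat X Y) (a : HanScheme V X Y)

lemma step_mem (s : HanState V X Y) : a.step sys s ∈ stdSimplex ℝ ((∀ j, V j) × (∀ j, Y j)) := by
  have hv := prod_mem_stdSimplex a.pV_mem
  refine ⟨fun e => mul_nonneg (hv.1 _) ((sys.chan_mem _).1 _), ?_⟩
  rw [Fintype.sum_prod_type]
  simp only [step, ← Finset.mul_sum, (sys.chan_mem _).2, mul_one]
  exact hv.2

lemma sum_init_mul (F : (∀ j, V j) → (∀ j, X j × Y j) → ℝ) :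
    ∑ s, a.init s * F (fun j => (s j).1) (fun j => (s j).2)
      = ∑ v, (∏ j, a.pV j (v j)) * ∑ w, a.q v w * F v w := by
  rw [sum_pi_prod]
  refine Finset.sum_congr rfl fun v _ => ?_
  rw [Finset.mul_sum]
  exact Finset.sum_congr rfl fun w _ => by rw [init, mul_assoc]

lemma init_mem : a.init ∈ stdSimplex ℝ (HanState V X Y) := by
  have hv := prod_mem_stdSimplex a.pV_mem
  refine ⟨fun s => mul_nonneg (hv.1 _) ((a.q_mem _).1 _), ?_⟩
  have := a.sum_init_mul fun _ _ => 1
  simp only [mul_one, (a.q_mem _).2] at this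
  rw [this]
  exact hv.2

lemma oneStep_mem : a.oneStep sys ∈ stdSimplex ℝ (HanState V X Y × ((∀ j, V j) × (∀ j, Y j))) := by
  refine ⟨fun x => mul_nonneg (a.init_mem.1 _) ((a.step_mem sys _).1 _), ?_⟩
  rw [Fintype.sum_prod_type]
  simp only [oneStep, ← Finset.mul_sum, (a.step_mem sys _).2, mul_one, a.init_mem.2]

lemma law_oneStep (j : Bool) (v : V j) :
    law (a.oneStep sys) (fun x => (x.1 j).1) v = a.pV j v := by
  classical
  rw [law_eq, Fintype.sum_prod_type]
  simp only [oneStep, mul_right_comm _ (a.step sys _ _), ← Finset.mul_sum, (a.step_mem sys _).2, mul_one]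
  rw [a.sum_init_mul fun v' _ => ind (v' j = v)]
  simp only [← Finset.sum_mul, (a.q_mem _).2, one_mul]
  rw [sum_prod_mul_resample a.pV j (a.pV_mem j).2]
  simp only [Function.update_self]
  rw [← Finset.sum_mul, (prod_mem_stdSimplex a.pV_mem).2, one_mul, Finset.sum_eq_single v]
  · rw [ind_of rfl, mul_one]
  · intro b _ hb; rw [ind_of_not hb, mul_zero]
  · simp

/-- The law of the previous codeword letter of terminal `j` given the view of terminal `!j`. -/
def post (j : Bool) : X (!j) × Y (!j) × V (!j) × (X (!j) × Y (!j)) → V j → ℝ :=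
  condLaw (a.oneStep sys) (fun x => (x.1 j).1) (fun x => a.view (!j) (x.1 (!j)) (x.2.1 (!j), x.2.2 (!j)))

lemma rate_eq (j : Bool) : a.rate sys j = ∑ s, a.init s * ∑ e, a.step sys s e *
    (Real.log (a.post sys j (a.view (!j) (s (!j)) (e.1 (!j), e.2 (!j))) (s j).1)
      - Real.log (a.pV j (s j).1)) := by
  rw [rate, mutualInfo_eq (a.oneStep_mem sys).1, Fintype.sum_prod_type]
  refine Finset.sum_congr rfl fun s _ => ?_
  rw [Finset.mul_sum]
  refine Finset.sum_congr rfl fun e _ => ?_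
  rw [law_oneStep, oneStep, post, mul_assoc]

/-! #### Blocks of consecutive channel uses -/

/-- The memory of terminal `i` before each of `L` channel uses. -/
def ownTraj (i : Bool) (L : ℕ) (τ : V i × (X i × Y i)) (v : Fin L → V i) (y : Fin L → Y i) :
    Fin L → V i × (X i × Y i) :=
  traj (a.ownNext i) L τ fun b => (v b, y b)

/-- The joint memory before each of `L` channel uses. -/
def jointTraj (L : ℕ) (s : HanState V X Y) (v : ∀ j, Fin L → V j) (y : Fin L → ∀ j, Y j) :
    Fin L → HanState V X Y :=
  traj a.next L s fun b => (fun j => v j b, y b)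

/-- A memory is updated from the terminal's own letter and own output, so each terminal can track it
alone; the terminals interact only through the channel. -/
lemma jointTraj_apply (L : ℕ) (s : HanState V X Y) (v : ∀ j, Fin L → V j) (y : Fin L → ∀ j, Y j)
    (b : Fin L) (i : Bool) :
    a.jointTraj L s v y b i = a.ownTraj i L (s i) (v i) (fun b => y b i) b :=
  map_traj (fun s : HanState V X Y => s i) (fun e : (∀ j, V j) × (∀ j, Y j) => (e.1 i, e.2 i))
    (fun _ _ => rfl) L s _ b

/-- The channel over `L` consecutive uses, as seen from the codeword letters. -/
def blockChan (L : ℕ) (s : HanState V X Y) (v : ∀ j, Fin L → V j) (y : Fin L → ∀ j, Y j) : ℝ :=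
  ∏ b, sys.chan (a.input (a.jointTraj L s v y b) fun j => v j b) (y b)

/-- Feedback does not spoil normalisation: each input depends only on earlier outputs, so later
outputs can be summed out first. -/
lemma blockChan_mem (L : ℕ) (s : HanState V X Y) (v : ∀ j, Fin L → V j) :
    a.blockChan sys L s v ∈ stdSimplex ℝ (Fin L → ∀ j, Y j) := by
  refine ⟨fun y => Finset.prod_nonneg fun b _ => (sys.chan_mem _).1 _, ?_⟩
  induction L generalizing s with
  | zero => simp [blockChan]
  | succ L ih =>
    rw [sum_cons]
    have : ∀ (y₀ : ∀ j, Y j) (y : Fin L → ∀ j, Y j), a.blockChan sys (L + 1) s v (Fin.cons y₀ y)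
        = sys.chan (a.input s fun j => v j 0) y₀ *
          a.blockChan sys L (a.next s (fun j => v j 0, y₀)) (fun j b => v j b.succ) y := by
      intro y₀ y
      simp [blockChan, jointTraj, Fin.prod_univ_succ]
    simp only [this, ← Finset.mul_sum, ih, mul_one]
    exact (sys.chan_mem _).2

lemma pathWeight_eq (L : ℕ) (s : HanState V X Y) (v : ∀ j, Fin L → V j) (y : Fin L → ∀ j, Y j) :
    pathWeight a.next (a.step sys) L s (fun b => (fun j => v j b, y b))
      = (∏ j, ∏ b, a.pV j (v j b)) * a.blockChan sys L s v y := by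
  rw [Finset.prod_comm, blockChan, ← Finset.prod_mul_distrib]
  rfl

/-- The joint law of the initial memories, the codeword letters and the channel outputs of `L` uses. -/
def blockLaw (L : ℕ) (x : HanState V X Y × (∀ j, Fin L → V j) × (Fin L → ∀ j, Y j)) : ℝ :=
  a.init x.1 * ((∏ j, ∏ b, a.pV j (x.2.1 j b)) * a.blockChan sys L x.1 x.2.1 x.2.2)

/-- Random coding indexes letters by terminal, the chain indexes them by time. The letters being
independent, a reordering identifies the block law with the path law. -/
lemma sum_blockLaw_mul (L : ℕ) (F : HanState V X Y → (Fin L → (∀ j, V j) × (∀ j, Y j)) → ℝ) :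
    ∑ x, a.blockLaw sys L x * F x.1 (fun b => (fun j => x.2.1 j b, x.2.2 b))
      = ∑ s, a.init s * ∑ e, pathWeight a.next (a.step sys) L s e * F s e := by
  rw [Fintype.sum_prod_type]
  refine Finset.sum_congr rfl fun s _ => ?_
  rw [Fintype.sum_prod_type, sum_pi_comm, sum_pi_prod, Finset.mul_sum]
  refine Finset.sum_congr rfl fun v _ => ?_
  rw [Finset.mul_sum]
  refine Finset.sum_congr rfl fun y _ => ?_
  rw [a.pathWeight_eq sys L s (fun j b => v b j) y, blockLaw, mul_assoc]

lemma blockLaw_mem (L : ℕ) : a.blockLaw sys L ∈ stdSimplex ℝ _ := by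
  refine ⟨fun x => mul_nonneg (a.init_mem.1 _) (mul_nonneg (Finset.prod_nonneg fun j _ =>
    Finset.prod_nonneg fun b _ => (a.pV_mem j).1 _) ((a.blockChan_mem sys _ _ _).1 _)), ?_⟩
  have := a.sum_blockLaw_mul sys L fun _ _ => 1
  simp only [mul_one, (pathWeight_mem (a.step_mem sys) L _).2, a.init_mem.2] at this
  exact this

/-- The law of the codeword letters of terminal `j`. -/
def letterLaw (j : Bool) (L : ℕ) (v : Fin L → V j) : ℝ := ∏ b, a.pV j (v b)

lemma letterLaw_mem (j : Bool) (L : ℕ) : a.letterLaw j L ∈ stdSimplex ℝ (Fin L → V j) :=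
  prod_mem_stdSimplex fun _ => a.pV_mem j

/-- The letters of terminal `j` weighted by their posterior laws given the later views of terminal `!j`. -/
def likelihood (j : Bool) (L : ℕ) (v : Fin (L + 1) → V j) (τ : V (!j) × (X (!j) × Y (!j)))
    (v' : Fin (L + 1) → V (!j)) (y : Fin (L + 1) → Y (!j)) : ℝ :=
  (∏ b : Fin L, a.post sys j (a.view (!j) (a.ownTraj (!j) (L + 1) τ v' y b.succ) (v' b.succ, y b.succ))
    (v b.castSucc)) * a.pV j (v (Fin.last L))

lemma likelihood_nonneg (j : Bool) (L : ℕ) (v : Fin (L + 1) → V j) (τ : V (!j) × (X (!j) × Y (!j)))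
    (v' : Fin (L + 1) → V (!j)) (y : Fin (L + 1) → Y (!j)) : 0 ≤ a.likelihood sys j L v τ v' y :=
  mul_nonneg (Finset.prod_nonneg fun _ _ => condLaw_nonneg (a.oneStep_mem sys).1 _ _ _ _)
    ((a.pV_mem j).1 _)

/-- For fixed views this is a product of sub-probability laws, one per letter. The last letter keeps
its prior, since the view that would reveal it lies beyond the block. -/
lemma sum_likelihood_le_one (j : Bool) (L : ℕ) (τ : V (!j) × (X (!j) × Y (!j)))
    (v' : Fin (L + 1) → V (!j)) (y : Fin (L + 1) → Y (!j)) :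
    ∑ v, a.likelihood sys j L v τ v' y ≤ 1 := by
  classical
  set g : Fin (L + 1) → V j → ℝ := Fin.lastCases (a.pV j) fun b =>
    a.post sys j (a.view (!j) (a.ownTraj (!j) (L + 1) τ v' y b.succ) (v' b.succ, y b.succ)) with hg
  have h : ∀ v, a.likelihood sys j L v τ v' y = ∏ b, g b (v b) := by
    intro v
    simp [likelihood, hg, Fin.prod_univ_castSucc]
  simp only [h]
  rw [← Fintype.prod_sum]
  refine Finset.prod_le_one (fun b _ => ?_) fun b _ => ?_
  · refine Finset.sum_nonneg fun x _ => ?_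
    induction b using Fin.lastCases with
    | last => simpa [hg] using (a.pV_mem j).1 x
    | cast b =>
      simp only [hg, Fin.lastCases_castSucc]
      exact condLaw_nonneg (a.oneStep_mem sys).1 _ _ _ _
  · induction b using Fin.lastCases with
    | last => simpa [hg] using (a.pV_mem j).2.le
    | cast b =>
      simp only [hg, Fin.lastCases_castSucc]
      exact sum_condLaw_le_one _ _ _ _

variable {sys a}

/-- By stationarity, the expected number of uses in a block at which the one-step law vanishes is
zero. -/
lemma oneStep_pos_of_blockLaw_pos (ha : a.IsStationary sys) {L : ℕ}
    {x : HanState V X Y × (∀ j, Fin L → V j) × (Fin L → ∀ j, Y j)} (hx : 0 < a.blockLaw sys L x)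
    (b : Fin L) :
    0 < a.oneStep sys (a.jointTraj L x.1 x.2.1 x.2.2 b, (fun j => x.2.1 j b, x.2.2 b)) := by
  refine lt_of_le_of_ne ((a.oneStep_mem sys).1 _) fun h0 => ?_
  have h := a.sum_blockLaw_mul sys L fun s e =>
    ∑ b, ind (a.oneStep sys (traj a.next L s e b, e b) = 0)
  rw [sum_pathWeight_mul (a.step_mem sys) ha L fun _ s e => ind (a.oneStep sys (s, e) = 0)] at h
  have hz : ∀ s, a.init s * ∑ e, a.step sys s e * ind (a.oneStep sys (s, e) = 0) = 0 := by
    intro s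
    rw [Finset.mul_sum]
    refine Finset.sum_eq_zero fun e _ => ?_
    by_cases he : a.oneStep sys (s, e) = 0
    · rw [ind_of he, mul_one]; exact he
    · rw [ind_of_not he, mul_zero, mul_zero]
  simp only [hz, Finset.sum_const_zero] at h
  rw [Finset.sum_eq_zero_iff_of_nonneg fun x _ => mul_nonneg ((a.blockLaw_mem sys L).1 x)
    (Finset.sum_nonneg fun b _ => ind_nonneg _)] at h
  rcases mul_eq_zero.1 (h x (Finset.mem_univ x)) with h1 | h1
  · exact hx.ne' h1
  · rw [Finset.sum_eq_zero_iff_of_nonneg fun b _ => ind_nonneg _] at h1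
    have h2 := h1 b (Finset.mem_univ b)
    rw [ind_of] at h2
    · exact one_ne_zero h2
    · exact h0.symm

lemma letterLaw_pos_of_blockLaw_pos {L : ℕ}
    {x : HanState V X Y × (∀ j, Fin L → V j) × (Fin L → ∀ j, Y j)} (hx : 0 < a.blockLaw sys L x)
    (j : Bool) (b : Fin L) : 0 < a.pV j (x.2.1 j b) := by
  refine lt_of_le_of_ne ((a.pV_mem j).1 _) fun h0 => hx.ne' ?_
  rw [blockLaw, Finset.prod_eq_zero (Finset.mem_univ j)
    (Finset.prod_eq_zero (Finset.mem_univ b) h0.symm)]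
  ring

lemma post_pos_of_blockLaw_pos (ha : a.IsStationary sys) {L : ℕ}
    {x : HanState V X Y × (∀ j, Fin (L + 1) → V j) × (Fin (L + 1) → ∀ j, Y j)}
    (hx : 0 < a.blockLaw sys (L + 1) x) (j : Bool) (b : Fin L) :
    0 < a.post sys j (a.view (!j) (a.ownTraj (!j) (L + 1) (x.1 (!j)) (x.2.1 (!j))
      (fun b => x.2.2 b (!j)) b.succ) (x.2.1 (!j) b.succ, x.2.2 b.succ (!j))) (x.2.1 j b.castSucc) := by
  have h := condLaw_pos (a.oneStep_mem sys).1 (fun x => (x.1 j).1)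
    (fun x => a.view (!j) (x.1 (!j)) (x.2.1 (!j), x.2.2 (!j))) (oneStep_pos_of_blockLaw_pos ha hx b.succ)
  have e : (a.jointTraj (L + 1) x.1 x.2.1 x.2.2 b.succ j).1 = x.2.1 j b.castSucc := by
    rw [jointTraj, traj_succ_eq_next]
    rfl
  rw [← a.jointTraj_apply, ← e]
  exact h

/-- The log-ratio splits into one term per use, and stationarity gives each the mean `a.rate sys j`.
The prior of the last letter cancels, leaving `L` terms out of `L + 1` uses. -/
lemma sum_blockLaw_log (ha : a.IsStationary sys) (j : Bool) (L : ℕ) :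
    ∑ x, a.blockLaw sys (L + 1) x * (Real.log (a.letterLaw j (L + 1) (x.2.1 j))
      - Real.log (a.likelihood sys j L (x.2.1 j) (x.1 (!j)) (x.2.1 (!j)) fun b => x.2.2 b (!j)))
      = -(L * a.rate sys j) := by
  -- The first use gets weight zero: its view concerns the letter stored in the initial memory,
  -- which is not part of the codeword.
  set f : Fin (L + 1) → HanState V X Y → (∀ j, V j) × (∀ j, Y j) → ℝ := Fin.cases (fun _ _ => 0)
    fun _ s e => Real.log (a.post sys j (a.view (!j) (s (!j)) (e.1 (!j), e.2 (!j))) (s j).1)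
      - Real.log (a.pV j (s j).1) with hf
  have h := a.sum_blockLaw_mul sys (L + 1) fun s e => ∑ b, f b (traj a.next (L + 1) s e b) (e b)
  rw [sum_pathWeight_mul (a.step_mem sys) ha] at h
  have hr : ∑ b, ∑ s, a.init s * ∑ e, a.step sys s e * f b s e = L * a.rate sys j := by
    rw [Fin.sum_univ_succ]
    simp only [hf, Fin.cases_zero, Fin.cases_succ, mul_zero, Finset.sum_const_zero, zero_add]
    rw [← a.rate_eq sys j]
    simp
  rw [hr] at h
  rw [← h, ← Finset.sum_neg_distrib]
  refine Finset.sum_congr rfl fun x _ => ?_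
  rcases ((a.blockLaw_mem sys (L + 1)).1 x).eq_or_lt with h0 | hpos
  · simp [← h0]
  · rw [← mul_neg]
    congr 1
    have h1 := letterLaw_pos_of_blockLaw_pos hpos j
    have h2 := post_pos_of_blockLaw_pos ha hpos j
    rw [letterLaw, Fin.prod_univ_castSucc, likelihood,
      Real.log_mul (Finset.prod_pos fun b _ => h1 _).ne' (h1 _).ne',
      Real.log_mul (Finset.prod_pos fun b _ => h2 _).ne' (h1 _).ne',
      Real.log_prod fun b _ => (h1 _).ne', Real.log_prod fun b _ => (h2 _).ne', Fin.sum_univ_succ]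
    simp only [hf, Fin.cases_zero, Fin.cases_succ, zero_add, Finset.sum_sub_distrib]
    have e1 : ∀ b : Fin L, (traj a.next (L + 1) x.1 (fun b => (fun j => x.2.1 j b, x.2.2 b)) b.succ j).1
        = x.2.1 j b.castSucc := by
      intro b
      rw [traj_succ_eq_next]
      rfl
    have e2 : ∀ b : Fin L, traj a.next (L + 1) x.1 (fun b => (fun j => x.2.1 j b, x.2.2 b)) b.succ (!j)
        = a.ownTraj (!j) (L + 1) (x.1 (!j)) (x.2.1 (!j)) (fun b => x.2.2 b (!j)) b.succ := fun b =>
      a.jointTraj_apply (L + 1) x.1 x.2.1 x.2.2 b.succ (!j)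
    simp only [e1, e2]
    ring

/-- The posterior test of the codeword of terminal `j`. -/
def Passes (sys : System S Shat X Y) (a : HanScheme V X Y) (j : Bool) (L n : ℕ) (θ : ℝ)
    (v : Fin n → Fin (L + 1) → V j) (z : Fin n → HanState V X Y) (v' : Fin n → Fin (L + 1) → V (!j))
    (y : Fin n → Fin (L + 1) → Y (!j)) : Prop :=
  ∏ i, a.letterLaw j (L + 1) (v i)
    ≤ Real.exp (-(n * θ)) * ∏ i, a.likelihood sys j L (v i) (z i (!j)) (v' i) (y i)

/-- On the passing set the prior is dominated by exp(-nθ) times the likelihood, whose total mass is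
at most one. No law of the outputs enters, so the bound is uniform in them. -/
lemma sum_passes_le (j : Bool) (L n : ℕ) (θ : ℝ) (z : Fin n → HanState V X Y)
    (v' : Fin n → Fin (L + 1) → V (!j)) (y : Fin n → Fin (L + 1) → Y (!j)) :
    ∑ v : Fin n → Fin (L + 1) → V j, (∏ i, a.letterLaw j (L + 1) (v i)) * ind (a.Passes sys j L n θ v z v' y)
      ≤ Real.exp (-(n * θ)) := by
  classical
  calc _ ≤ ∑ v : Fin n → Fin (L + 1) → V j,
          Real.exp (-(n * θ)) * ∏ i, a.likelihood sys j L (v i) (z i (!j)) (v' i) (y i) := by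
        refine Finset.sum_le_sum fun v _ => ?_
        by_cases hc : a.Passes sys j L n θ v z v' y
        · rw [ind_of hc, mul_one]; exact hc
        · rw [ind_of_not hc, mul_zero]
          exact mul_nonneg (Real.exp_pos _).le (Finset.prod_nonneg fun i _ => a.likelihood_nonneg sys _ _ _ _ _ _)
    _ = Real.exp (-(n * θ)) * ∏ i, ∑ v, a.likelihood sys j L v (z i (!j)) (v' i) (y i) := by
        rw [← Finset.mul_sum, Fintype.prod_sum]
    _ ≤ Real.exp (-(n * θ)) * 1 :=
        mul_le_mul_of_nonneg_left (Finset.prod_le_one (fun i _ => Finset.sum_nonneg fun v _ =>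
          a.likelihood_nonneg sys _ _ _ _ _ _) fun i _ => a.sum_likelihood_le_one sys _ _ _ _ _)
          (Real.exp_pos _).le
    _ = _ := mul_one _

/-- The blocks are i.i.d. because the initial memories are drawn independently, so Chernoff's bound
applies for any θ below the mean log-ratio of a block. -/
lemma exists_passes_tail (ha : a.IsStationary sys) (j : Bool) (L : ℕ) {θ : ℝ}
    (hθ : θ < L * a.rate sys j) :
    ∃ ρ : ℝ, 0 ≤ ρ ∧ ρ < 1 ∧ ∀ n : ℕ,
      ∑ z : Fin n → HanState V X Y, ∑ c : ∀ j, Fin n → Fin (L + 1) → V j,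
        ∑ o : Fin n → Fin (L + 1) → ∀ j, Y j,
          (∏ i, a.init (z i)) * (∏ j, ∏ i, a.letterLaw j (L + 1) (c j i)) *
            (∏ i, a.blockChan sys (L + 1) (z i) (fun j => c j i) (o i)) *
            ind (¬a.Passes sys j L n θ (c j) z (c (!j)) fun i b => o i b (!j)) ≤ ρ ^ n := by
  obtain ⟨ρ, h0, h1, hρ⟩ := exists_pow_bound_prod (a.blockLaw_mem sys (L + 1))
    (u := fun x => a.letterLaw j (L + 1) (x.2.1 j))
    (v := fun x => a.likelihood sys j L (x.2.1 j) (x.1 (!j)) (x.2.1 (!j)) fun b => x.2.2 b (!j))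
    (fun x hx => Finset.prod_pos fun b _ => letterLaw_pos_of_blockLaw_pos hx j b)
    (fun x hx => mul_pos (Finset.prod_pos fun b _ => post_pos_of_blockLaw_pos ha hx j b)
      (letterLaw_pos_of_blockLaw_pos hx j _))
    (c := -θ) (by rw [sum_blockLaw_log ha]; linarith)
  refine ⟨ρ, h0, h1, fun n => le_trans (le_of_eq ?_) (hρ n)⟩
  rw [sum_pi_prod]
  refine Finset.sum_congr rfl fun z _ => ?_
  rw [sum_pi_prod, sum_pi_comm]
  refine Finset.sum_congr rfl fun c _ => Finset.sum_congr rfl fun o _ => ?_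
  simp only [blockLaw, Passes, Finset.prod_mul_distrib, mul_neg]
  rw [Finset.prod_comm]
  simp only [letterLaw, mul_assoc]

end HanScheme

/-! ### From separate configurations to Han schemes -/

section Reduction

variable {S Shat X Y V T : Bool → Type*}
  [∀ j, Fintype (S j)] [∀ j, Fintype (Shat j)] [∀ j, Fintype (X j)] [∀ j, Fintype (Y j)]
  [∀ j, Fintype (V j)] [∀ j, Fintype (T j)]

lemma sum_state {U : Bool → Type*} [∀ j, Fintype (U j)] (F : State S X Y U → ℝ) :
    ∑ z, F z = ∑ sT, ∑ uT, ∑ wT, ∑ s, ∑ u, ∑ x, ∑ y, F ⟨s, u, sT, uT, wT, x, y⟩ := by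
  let e : ((∀ j, S j) × (∀ j, U j) × (∀ j, X j × Y j) × (∀ j, S j) × (∀ j, U j) × (∀ j, X j) × (∀ j, Y j))
      ≃ State S X Y U :=
    { toFun := fun t => ⟨t.2.2.2.1, t.2.2.2.2.1, t.1, t.2.1, t.2.2.1, t.2.2.2.2.2.1, t.2.2.2.2.2.2⟩
      invFun := fun z => (z.sT, z.uT, z.wT, z.s, z.u, z.x, z.y)
      left_inv := fun _ => rfl
      right_inv := fun _ => rfl }
  rw [← e.sum_comp]
  simp only [Fintype.sum_prod_type]
  rfl

lemma sum_innovation_mul {U : Bool → Type*} [∀ j, Fintype (U j)] (sys : System S Shat X Y)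
    (c : Configuration S Shat X Y U) (sT : ∀ j, S j) (uT : ∀ j, U j) (wT : ∀ j, X j × Y j)
    (F : (∀ j, S j) → (∀ j, U j) → (∀ j, X j) → (∀ j, Y j) → ℝ) :
    ∑ s, ∑ u, ∑ x, ∑ y, c.innovation sys ⟨s, u, sT, uT, wT, x, y⟩ * F s u x y
      = ∑ s, ∑ u, sys.src s * (∏ j, c.PU j (s j) (u j)) *
          ∑ y, sys.chan (fun j => c.F j (s j) (u j) (sT j) (uT j) (wT j)) y
            * F s u (fun j => c.F j (s j) (u j) (sT j) (uT j) (wT j)) y := by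
  classical
  refine Finset.sum_congr rfl fun s _ => Finset.sum_congr rfl fun u _ => ?_
  set x₀ : ∀ j, X j := fun j => c.F j (s j) (u j) (sT j) (uT j) (wT j) with hx₀
  rw [Finset.sum_eq_single x₀]
  · rw [Finset.mul_sum]
    refine Finset.sum_congr rfl fun y _ => ?_
    simp only [Configuration.innovation]
    rw [Finset.prod_eq_one fun j _ => if_pos rfl]
    ring
  · intro x _ hx
    obtain ⟨j, hj⟩ := Function.ne_iff.1 hx
    refine Finset.sum_eq_zero fun y _ => ?_
    simp only [Configuration.innovation]
    rw [Finset.prod_eq_zero (f := fun j => if x j = c.F j (s j) (u j) (sT j) (uT j) (wT j) then (1 : ℝ) else 0)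
      (Finset.mem_univ j) (if_neg hj)]
    ring
  · simp

lemma sum_innovation {U : Bool → Type*} [∀ j, Fintype (U j)] (sys : System S Shat X Y)
    (c : Configuration S Shat X Y U) (sT : ∀ j, S j) (uT : ∀ j, U j) (wT : ∀ j, X j × Y j) :
    ∑ s, ∑ u, ∑ x, ∑ y, c.innovation sys ⟨s, u, sT, uT, wT, x, y⟩ = 1 := by
  classical
  have h := sum_innovation_mul sys c sT uT wT fun _ _ _ _ => 1
  simp only [mul_one, (sys.chan_mem _).2] at h
  rw [h]
  simp only [← Finset.mul_sum, (prod_mem_stdSimplex fun j => c.PU_mem j _).2, mul_one, sys.src_mem.2]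

open Classical in
lemma prod_ite_eq_ind {J : Type*} [Fintype J] {α : J → Type*} (f g : ∀ j, α j) :
    (∏ j, if f j = g j then (1 : ℝ) else 0) = ind (f = g) := by
  by_cases h : f = g
  · rw [ind_of h, Finset.prod_eq_one fun j _ => if_pos (congrFun h j)]
  · obtain ⟨j, hj⟩ := Function.ne_iff.1 h
    rw [ind_of_not h, Finset.prod_eq_zero (Finset.mem_univ j) (if_neg hj)]

lemma sum_kernel_mul {U : Bool → Type*} [∀ j, Fintype (U j)] (sys : System S Shat X Y)
    (c : Configuration S Shat X Y U) (z' : State S X Y U)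
    (F : (∀ j, U j) → (∀ j, X j × Y j) → ℝ) :
    ∑ z, c.kernel sys z' z * F z.uT z.wT = F z'.u fun j => (z'.x j, z'.y j) := by
  classical
  have hk : ∀ z, c.kernel sys z' z = ind (z.sT = z'.s) * ind (z.uT = z'.u)
      * ind (z.wT = fun j => (z'.x j, z'.y j)) * c.innovation sys z := by
    intro z
    rw [← prod_ite_eq_ind, ← prod_ite_eq_ind, ← prod_ite_eq_ind]
    simp only [Configuration.kernel, Finset.prod_mul_distrib]
    congr!
  simp only [hk]
  rw [sum_state, Finset.sum_eq_single z'.s, Finset.sum_eq_single z'.u,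
    Finset.sum_eq_single fun j => (z'.x j, z'.y j)]
  · simp only [ind_of, one_mul, ← Finset.sum_mul]
    rw [sum_innovation, one_mul]
  · intro w _ hw
    simp [ind_of_not hw]
  · simp
  · intro u _ hu
    simp [ind_of_not hu]
  · simp
  · intro s _ hs
    simp [ind_of_not hs]
  · simp

/-- A configuration that implements Wyner-Ziv coding and Han's adaptive channel coding separately. -/
structure IsSeparate (sys : System S Shat X Y) (c : Configuration S Shat X Y fun j => V j × T j)
    (a : HanScheme V X Y) (pT : ∀ j, S j → T j → ℝ) : Prop where
  pT_mem : ∀ j s, pT j s ∈ stdSimplex ℝ (T j)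
  PU_eq : ∀ j s v t, c.PU j s (v, t) = a.pV j v * pT j s t
  PT_eq : ∀ s u, c.PT (s, u) = sys.src s * ∏ j, a.pV j (u j).1 * pT j (s j) (u j).2
  PW_eq : ∀ s u, c.PW s u = a.q fun j => (u j).1
  F_eq : ∀ j s u s' u' w, c.F j s u s' u' w = a.γ j u.1 u'.1 w

namespace IsSeparate

variable {sys : System S Shat X Y} {c : Configuration S Shat X Y fun j => V j × T j}
  {a : HanScheme V X Y} {pT : ∀ j, S j → T j → ℝ}

lemma sum_src_mul (hc : IsSeparate sys c a pT) (g : (∀ j, V j) → ℝ) :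
    ∑ s, ∑ u : ∀ j, V j × T j, sys.src s * (∏ j, a.pV j (u j).1 * pT j (s j) (u j).2) * g (fun j => (u j).1)
      = ∑ v, (∏ j, a.pV j (v j)) * g v := by
  have h : ∀ s, ∑ u : ∀ j, V j × T j,
      sys.src s * (∏ j, a.pV j (u j).1 * pT j (s j) (u j).2) * g (fun j => (u j).1)
        = sys.src s * ∑ v, (∏ j, a.pV j (v j)) * g v := by
    intro s
    rw [sum_pi_prod, Finset.mul_sum]
    refine Finset.sum_congr rfl fun v _ => ?_
    have := (prod_mem_stdSimplex fun j => hc.pT_mem j (s j)).2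
    simp only [Finset.prod_mul_distrib]
    calc _ = sys.src s * ((∏ j, a.pV j (v j)) * g v) * ∑ t : ∀ j, T j, ∏ j, pT j (s j) (t j) := by
          rw [Finset.mul_sum]
          exact Finset.sum_congr rfl fun t _ => by ring
      _ = _ := by rw [this, mul_one]
  simp only [h]
  rw [← Finset.sum_mul, sys.src_mem.2, one_mul]

/-- The channel inputs ignore the sources and the `T` components, so these integrate out and leave
the one-step law of the Han scheme. -/
lemma sum_PZ_mul (hc : IsSeparate sys c a pT)
    (F : (∀ j, V j) → (∀ j, X j × Y j) → (∀ j, V j) → (∀ j, X j) → (∀ j, Y j) → ℝ) :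
    ∑ z, c.PZ sys z * F (fun j => (z.uT j).1) z.wT (fun j => (z.u j).1) z.x z.y
      = ∑ x, a.oneStep sys x
          * F (fun j => (x.1 j).1) (fun j => (x.1 j).2) x.2.1 (a.input x.1 x.2.1) x.2.2 := by
  classical
  rw [sum_state]
  have h1 : ∀ (sT : ∀ j, S j) (uT : ∀ j, V j × T j) (wT : ∀ j, X j × Y j),
      ∑ s, ∑ u, ∑ x, ∑ y, c.PZ sys ⟨s, u, sT, uT, wT, x, y⟩
        * F (fun j => (uT j).1) wT (fun j => (u j).1) x y
      = c.PT (sT, uT) * (a.q (fun j => (uT j).1) wT * ∑ v, (∏ j, a.pV j (v j)) *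
          ∑ y, sys.chan (a.input (fun j => ((uT j).1, wT j)) v) y
            * F (fun j => (uT j).1) wT v (a.input (fun j => ((uT j).1, wT j)) v) y) := by
    intro sT uT wT
    rw [← hc.sum_src_mul]
    have := sum_innovation_mul sys c sT uT wT fun _ u x y => F (fun j => (uT j).1) wT (fun j => (u j).1) x y
    simp only [hc.F_eq] at this
    have hPU : ∀ (s : ∀ j, S j) (u : ∀ j, V j × T j),
        ∏ j, c.PU j (s j) (u j) = ∏ j, a.pV j (u j).1 * pT j (s j) (u j).2 := fun s u =>
      Finset.prod_congr rfl fun j _ => hc.PU_eq j (s j) (u j).1 (u j).2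
    simp only [hPU] at this
    have e : ∀ u : ∀ j, V j × T j, a.input (fun j => ((uT j).1, wT j)) (fun j => (u j).1)
        = fun j => a.γ j (u j).1 (uT j).1 (wT j) := fun u => rfl
    simp only [e]
    rw [← this]
    simp only [Configuration.PZ, hc.PW_eq, mul_assoc, Finset.mul_sum]
  simp only [h1, ← Finset.mul_sum]
  simp only [hc.PT_eq]
  rw [hc.sum_src_mul fun vT => ∑ wT, a.q vT wT * ∑ v, (∏ j, a.pV j (v j)) *
          ∑ y, sys.chan (a.input (fun j => (vT j, wT j)) v) y
            * F vT wT v (a.input (fun j => (vT j, wT j)) v) y]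
  rw [← a.sum_init_mul fun vT wT => ∑ v, (∏ j, a.pV j (v j)) *
          ∑ y, sys.chan (a.input (fun j => (vT j, wT j)) v) y
            * F vT wT v (a.input (fun j => (vT j, wT j)) v) y, Fintype.sum_prod_type]
  refine Finset.sum_congr rfl fun s _ => ?_
  rw [Fintype.sum_prod_type, Finset.mul_sum]
  refine Finset.sum_congr rfl fun v _ => ?_
  rw [Finset.mul_sum, Finset.mul_sum]
  refine Finset.sum_congr rfl fun y _ => ?_
  simp only [HanScheme.oneStep, HanScheme.step]
  ring

/-- Stationarity of the configuration is tested only against functions of the previous letters,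
inputs and outputs. -/
lemma isStationary (hc : IsSeparate sys c a pT) (hs : c.IsStationary sys) : a.IsStationary sys := by
  intro F
  have h1 := hc.sum_PZ_mul fun vT wT _ _ _ => F fun j => (vT j, wT j)
  have h2 := hc.sum_PZ_mul fun _ _ v x y => F fun j => (v j, x j, y j)
  have h3 : ∑ z, c.PZ sys z * F (fun j => ((z.uT j).1, z.wT j))
      = ∑ z, c.PZ sys z * F (fun j => ((z.u j).1, z.x j, z.y j)) := by
    calc _ = ∑ z, ∑ z', c.PZ sys z' * (c.kernel sys z' z * F (fun j => ((z.uT j).1, z.wT j))) := by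
          refine Finset.sum_congr rfl fun z _ => ?_
          rw [← hs z, Finset.sum_mul]
          exact Finset.sum_congr rfl fun z' _ => mul_assoc _ _ _
      _ = ∑ z', c.PZ sys z' * ∑ z, c.kernel sys z' z * F (fun j => ((z.uT j).1, z.wT j)) := by
          rw [Finset.sum_comm]
          simp only [Finset.mul_sum]
      _ = _ := by
          refine Finset.sum_congr rfl fun z' _ => ?_
          rw [sum_kernel_mul sys c z' fun u w => F fun j => ((u j).1, w j)]
  rw [h1, h2, Fintype.sum_prod_type, Fintype.sum_prod_type] at h3
  simp only [HanScheme.oneStep, mul_assoc, ← Finset.mul_sum, ← Finset.sum_mul,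
    (a.step_mem sys _).2, one_mul] at h3
  exact h3.symm

lemma law_PZ (hc : IsSeparate sys c a pT) {α : Type*} (A : State S X Y (fun j => V j × T j) → α)
    (A' : (∀ j, V j) → (∀ j, X j × Y j) → (∀ j, V j) → (∀ j, X j) → (∀ j, Y j) → α)
    (h : ∀ z, A z = A' (fun j => (z.uT j).1) z.wT (fun j => (z.u j).1) z.x z.y) :
    law (c.PZ sys) A = law (a.oneStep sys) fun x =>
      A' (fun j => (x.1 j).1) (fun j => (x.1 j).2) x.2.1 (a.input x.1 x.2.1) x.2.2 := by
  funext b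
  rw [law_eq, law_eq, ← hc.sum_PZ_mul fun vT wT v x y => ind (A' vT wT v x y = b)]
  exact Finset.sum_congr rfl fun z _ => by rw [h]

lemma hanRate_eq (hc : IsSeparate sys c a pT) (j : Bool) : sys.hanRate c j = a.rate sys j := by
  have k1 := hc.law_PZ (fun z => (z.uT j).1) (fun vT _ _ _ _ => vT j) fun _ => rfl
  have k2 := hc.law_PZ (fun z => (z.x (!j), z.y (!j), (z.uT (!j)).1, z.wT (!j)))
    (fun vT wT _ x y => (x (!j), y (!j), vT (!j), wT (!j))) fun _ => rfl
  have k3 := hc.law_PZ (fun z => ((z.uT j).1, z.x (!j), z.y (!j), (z.uT (!j)).1, z.wT (!j)))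
    (fun vT wT _ x y => (vT j, x (!j), y (!j), vT (!j), wT (!j))) fun _ => rfl
  simp only [System.hanRate, HanScheme.rate, mutualInfo, entropy, k1, k2, k3]
  rfl

end IsSeparate

end Reduction

/-! ### The block code and its distortion -/

section BlockCode

variable {S Shat X Y V : Bool → Type*}
  [∀ j, Fintype (S j)] [∀ j, Fintype (Shat j)] [∀ j, Fintype (X j)] [∀ j, Fintype (Y j)]
  [∀ j, Fintype (V j)]

open Classical in
/-- The code that sends the codewords `w` over `n` blocks of `L` consecutive channel uses, the memories being
reset to `z` at the beginning of each block. -/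
def HanScheme.blockCode (a : HanScheme V X Y) {n L K : ℕ} (y₀ : ∀ j, Y j)
    (z : Fin n → HanScheme.HanState V X Y) (w : ∀ j, (Fin K → S j) → Fin n → Fin L → V j)
    (g : ∀ j, (Fin K → S (!j)) → (Fin n → Fin L → Y (!j)) → Fin K → Shat j) :
    Code S Shat X Y (n * L) K where
  enc j m s y :=
    let i := (finProdFinEquiv.symm m).1
    let b := (finProdFinEquiv.symm m).2
    let τ := a.ownTraj j L (z i j) (w j s i)
      -- `y₀` stands in for outputs not yet received; by `traj_congr` they do not affect the memory
      -- before use `b`.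
      (fun b' => if h : finProdFinEquiv (i, b') < m then y ⟨finProdFinEquiv (i, b'), h⟩ else y₀ j) b
    a.γ j (w j s i b) τ.1 τ.2
  dec j s y := g j s fun i b => y (finProdFinEquiv (i, b))

variable (sys : System S Shat X Y) (a : HanScheme V X Y) {n L K : ℕ} (y₀ : ∀ j, Y j)
  (z : Fin n → HanScheme.HanState V X Y) (w : ∀ j, (Fin K → S j) → Fin n → Fin L → V j)
  (g : ∀ j, (Fin K → S (!j)) → (Fin n → Fin L → Y (!j)) → Fin K → Shat j)

omit [∀ j, Fintype (S j)] [∀ j, Fintype (Shat j)] in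
lemma HanScheme.blockCode_input (s : ∀ j, Fin K → S j) (y : ∀ j, Fin (n * L) → Y j) (i : Fin n) (b : Fin L) :
    (a.blockCode y₀ z w g).input s y (finProdFinEquiv (i, b))
      = a.input (a.jointTraj L (z i) (fun j => w j (s j) i)
          (fun b j => y j (finProdFinEquiv (i, b))) b) fun j => w j (s j) i b := by
  funext j
  simp only [Code.input, blockCode, HanScheme.input, Equiv.symm_apply_apply, jointTraj_apply]
  have : ∀ y' : Fin L → Y j, (∀ b' < b, y' b' = y j (finProdFinEquiv (i, b'))) →
      a.ownTraj j L (z i j) (w j (s j) i) y' b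
        = a.ownTraj j L (z i j) (w j (s j) i) (fun b' => y j (finProdFinEquiv (i, b'))) b := by
    intro y' hy'
    exact traj_congr _ _ _ _ fun b' hb' => by rw [hy' b' hb']
  rw [this]
  intro b' hb'
  have hlt : finProdFinEquiv (i, b') < finProdFinEquiv (i, b) := by
    rw [Fin.lt_def] at hb' ⊢
    simpa [finProdFinEquiv] using hb'
  rw [dif_pos hlt]
  rfl

lemma HanScheme.blockCode_jointLaw (s : ∀ j, Fin K → S j) (y : ∀ j, Fin (n * L) → Y j) :
    (a.blockCode y₀ z w g).jointLaw sys s y = sys.srcBlock K s *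
      ∏ i, a.blockChan sys L (z i) (fun j => w j (s j) i) fun b j => y j (finProdFinEquiv (i, b)) := by
  rw [Code.jointLaw, System.srcBlock, ← finProdFinEquiv.prod_comp, Fintype.prod_prod_type]
  simp only [HanScheme.blockCode_input, blockChan]

/-- Channel outputs arranged in blocks. -/
def blockEquiv (Y : Bool → Type*) (n L : ℕ) :
    (Fin n → Fin L → ∀ j, Y j) ≃ (∀ j, Fin (n * L) → Y j) where
  toFun o j m := o (finProdFinEquiv.symm m).1 (finProdFinEquiv.symm m).2 j
  invFun y i b j := y j (finProdFinEquiv (i, b))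
  left_inv o := by
    funext i b j
    simp only [Equiv.symm_apply_apply]
  right_inv y := by
    funext j m
    simp only [Prod.mk.eta, Equiv.apply_symm_apply]

lemma HanScheme.blockCode_distortion (j : Bool) :
    (a.blockCode y₀ z w g).distortion sys j = ∑ s, sys.srcBlock K s *
      ∑ o : Fin n → Fin L → ∀ j, Y j, (∏ i, a.blockChan sys L (z i) (fun j => w j (s j) i) (o i)) *
        ((K : ℝ)⁻¹ * ∑ k, sys.dist j (s j k) (g j (s (!j)) (fun i b => o i b (!j)) k)) := by
  rw [Code.distortion]
  refine Finset.sum_congr rfl fun s _ => ?_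
  rw [← (blockEquiv Y n L).sum_comp, Finset.mul_sum]
  refine Finset.sum_congr rfl fun o _ => ?_
  have h : ∀ i b, (fun j => blockEquiv Y n L o j (finProdFinEquiv (i, b))) = o i b := fun i b => by
    funext j
    exact congrFun (congrFun (congrFun ((blockEquiv Y n L).left_inv o) i) b) j
  have h' : ∀ j i b, blockEquiv Y n L o j (finProdFinEquiv (i, b)) = o i b j := fun j i b =>
    congrFun (h i b) j
  rw [HanScheme.blockCode_jointLaw]
  simp only [HanScheme.blockCode, h', mul_assoc]

end BlockCode

/-! ### Joining the two codes -/

section Achievability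

variable {S Shat X Y V T : Bool → Type*}
  [∀ j, Fintype (S j)] [∀ j, Fintype (Shat j)] [∀ j, Fintype (X j)] [∀ j, Fintype (Y j)]
  [∀ j, Fintype (V j)] [∀ j, Fintype (T j)]

lemma System.dist_le_sum (sys : System S Shat X Y) (j : Bool) (s : S j) (t : Shat j) :
    sys.dist j s t ≤ ∑ s, ∑ t, sys.dist j s t :=
  (Finset.single_le_sum (f := fun t => sys.dist j s t) (fun _ _ => sys.dist_nonneg j _ _)
    (Finset.mem_univ t)).trans
  (Finset.single_le_sum (f := fun s => ∑ t, sys.dist j s t)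
    (fun _ _ => Finset.sum_nonneg fun _ _ => sys.dist_nonneg j _ _) (Finset.mem_univ s))

/-- Separate Wyner-Ziv and adaptive channel coding with `K` source symbols and `K / (L + 1) + 1` blocks of
`L + 1` channel uses. -/
lemma eventually_exists_code {sys : System S Shat X Y} {a : HanScheme V X Y} (ha : a.IsStationary sys)
    {pT : ∀ j, S j → T j → ℝ} (hpT : ∀ j s, pT j s ∈ stdSimplex ℝ (T j)) (h : ∀ j, T j → S (!j) → Shat j)
    {D r : Bool → ℝ} (hD : ∀ j, sys.wzDistortion j (pT j) (h j) ≤ D j) (hD0 : ∀ j, 0 ≤ D j)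
    (hr0 : ∀ j, 0 ≤ r j) (hr : ∀ j, sys.wzInfo j (pT j) < r j) (L : ℕ)
    (hL : ∀ j, (L + 1) * r j < L * a.rate sys j) {ε : ℝ} (hε : 0 < ε) :
    ∀ᶠ K : ℕ in atTop, ∃ c : Code S Shat X Y ((K / (L + 1) + 1) * (L + 1)) K,
      ∀ j, c.distortion sys j ≤ D j + ε := by
  classical
  set B : ℝ := ∑ j, ∑ s, ∑ t, sys.dist j s t with hB
  have hBj : ∀ j s t, sys.dist j s t ≤ B := fun j s t => (sys.dist_le_sum j s t).trans
    (Finset.single_le_sum (f := fun j => ∑ s, ∑ t, sys.dist j s t) (fun j _ => Finset.sum_nonneg fun _ _ =>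
      Finset.sum_nonneg fun _ _ => sys.dist_nonneg j _ _) (Finset.mem_univ j))
  have hB0 : 0 ≤ B := Finset.sum_nonneg fun j _ => Finset.sum_nonneg fun _ _ =>
      Finset.sum_nonneg fun _ _ => sys.dist_nonneg j _ _
  -- One ε' is distortion slack. The five multiplied by `B` are one for source failure and four for
  -- the channel: a failed test and a false candidate in each direction.
  obtain ⟨ε', hε', hεε⟩ : ∃ ε' : ℝ, 0 < ε' ∧ ε' + B * (5 * ε') = ε :=
    ⟨ε / (1 + 5 * B), by positivity, by field_simp⟩
  choose ρ hρ0 hρ1 hρ using fun j => HanScheme.exists_passes_tail ha j L (hL j)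
  have hn : Tendsto (fun K : ℕ => K / (L + 1) + 1) atTop atTop :=
    (tendsto_add_atTop_nat 1).comp (Nat.tendsto_div_const_atTop (Nat.succ_ne_zero L))
  have hρlim : ∀ j, ∀ᶠ K : ℕ in atTop, ρ j ^ (K / (L + 1) + 1) < ε' := fun j =>
    ((tendsto_pow_atTop_nhds_zero_of_lt_one (hρ0 j) (hρ1 j)).comp hn).eventually (gt_mem_nhds hε')
  have hsrc : ∀ j, ∀ᶠ K : ℕ in atTop, _ := fun j =>
    sys.exists_wz_codebook (hpT j) (h j) (hD j) (hr j) hε'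
  filter_upwards [eventually_all.2 hρlim, eventually_all.2 hsrc, eventually_gt_atTop 0] with K e1 e2 hK
  choose M cb k cmp hcb using e2
  -- The additional block ensures n(L + 1) ≥ K, so that the channel test has exponent at least K r.
  set n : ℕ := K / (L + 1) + 1 with hndef
  have hKn : (K : ℝ) ≤ n * (L + 1) := by
    have : K ≤ n * (L + 1) := by
      have := Nat.div_add_mod K (L + 1)
      have h2 : K % (L + 1) < L + 1 := Nat.mod_lt K (Nat.succ_pos L)
      rw [hndef, add_mul, mul_comm]
      omega
    exact_mod_cast this
  obtain ⟨z, f, hzf⟩ := exists_channel_codebook (ι := fun j => Fin (M j)) (A := fun j => Fin K → S j)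
    (C := fun j => Fin n → Fin (L + 1) → V j) (sys.srcBlock_mem K) k (fun j m s' => cmp j (cb j m) s')
    (pC := fun j v => ∏ i, a.letterLaw j (L + 1) (v i))
    (fun j => prod_mem_stdSimplex fun _ : Fin n => a.letterLaw_mem j (L + 1))
    (μ := fun z : Fin n → HanScheme.HanState V X Y => ∏ i, a.init (z i))
    (prod_mem_stdSimplex fun _ : Fin n => a.init_mem)
    (W := fun z c (o : Fin n → Fin (L + 1) → ∀ j, Y j) =>
      ∏ i, a.blockChan sys (L + 1) (z i) (fun j => c j i) (o i))
    (fun z c => prod_mem_stdSimplex fun i => a.blockChan_mem sys (L + 1) (z i) fun j => c j i)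
    (fun j v z v' o => a.Passes sys j L n ((L + 1) * r j) v z v' fun i b => o i b (!j))
    (β := fun j => Real.exp (-(n * ((L + 1) * r j)))) (δ := fun j => ρ j ^ n)
    (fun j z c' o => HanScheme.sum_passes_le j L n _ z c' _) (fun j => hρ j n)
  obtain ⟨s₀, -⟩ := exists_le_of_sum_mul_le (f := fun _ => (0 : ℝ)) (c := 0) (sys.srcBlock_mem K) (by simp)
  obtain ⟨y₀⟩ : Nonempty (∀ j, Y j) := by
    obtain ⟨s, -⟩ := exists_le_of_sum_mul_le (f := fun _ => (0 : ℝ)) (c := 0) a.init_mem (by simp)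
    exact ⟨fun j => (s j).2.2⟩
  have hne : ∀ j, Nonempty (Fin (M j)) := fun j => ⟨k j (s₀ j)⟩
  -- The decoder takes any index that passes both tests; outside the error events the true index is
  -- the only one.
  set g : ∀ j, (Fin K → S (!j)) → (Fin n → Fin (L + 1) → Y (!j)) → Fin K → Shat j := fun j s' o' i =>
    h j (cb j (Classical.epsilon fun m => cmp j (cb j m) s' ∧
      a.Passes sys j L n ((L + 1) * r j) (f j m) z (f (!j) (k (!j) s')) o') i) (s' i) with hg
  refine ⟨a.blockCode y₀ z (fun j s => f j (k j s)) g, fun j => ?_⟩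
  rw [a.blockCode_distortion]
  set W : (∀ j, Fin K → S j) → (Fin n → Fin (L + 1) → ∀ j, Y j) → ℝ := fun s o =>
    ∏ i, a.blockChan sys (L + 1) (z i) (fun j => f j (k j (s j)) i) (o i) with hWdef
  have hW : ∀ s, W s ∈ stdSimplex ℝ (Fin n → Fin (L + 1) → ∀ j, Y j) := fun s =>
    prod_mem_stdSimplex fun i => a.blockChan_mem sys (L + 1) (z i) fun j => f j (k j (s j)) i
  have hP := sys.srcBlock_mem K
  set bad : Bool → (∀ j, Fin K → S j) → (Fin n → Fin (L + 1) → ∀ j, Y j) → Prop := fun j s o =>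
    ¬a.Passes sys j L n ((L + 1) * r j) (f j (k j (s j))) z (f (!j) (k (!j) (s (!j)))) (fun i b => o i b (!j)) ∨
      ∃ m, m ≠ k j (s j) ∧ cmp j (cb j m) (s (!j)) ∧
        a.Passes sys j L n ((L + 1) * r j) (f j m) z (f (!j) (k (!j) (s (!j)))) (fun i b => o i b (!j)) with hbad
  set bads : Bool → (∀ j, Fin K → S j) → Prop := fun j s => ¬(cmp j (cb j (k j (s j))) (s (!j)) ∧
          ∑ i, sys.dist j (s j i) (h j (cb j (k j (s j)) i) (s (!j) i)) ≤ K * (D j + ε')) with hbads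
  have hpt : ∀ s o, (K : ℝ)⁻¹ * ∑ i, sys.dist j (s j i) (g j (s (!j)) (fun i b => o i b (!j)) i)
      ≤ D j + ε' + B * (ind (bads j s) + ind (bad j s o)) := by
    intro s o
    have hKpos : (0 : ℝ) < K := by exact_mod_cast hK
    by_cases hb : bads j s ∨ bad j s o
    · have h1 : (1 : ℝ) ≤ ind (bads j s) + ind (bad j s o) := (ind_of hb).ge.trans (ind_or_le _ _)
      have h2 : (K : ℝ)⁻¹ * ∑ i, sys.dist j (s j i) (g j (s (!j)) (fun i b => o i b (!j)) i) ≤ B := by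
        rw [inv_mul_le_iff₀ hKpos]
        refine (Finset.sum_le_sum fun i _ => hBj j _ _).trans (le_of_eq ?_)
        simp
      nlinarith [hD0 j]
    · rw [not_or] at hb
      obtain ⟨hb1, hb2⟩ := hb
      obtain ⟨hc1, hc2⟩ := not_not.1 hb1
      have hb3 := not_not.1 fun hx => hb2 (Or.inl hx)
      have hdec : (Classical.epsilon fun m => cmp j (cb j m) (s (!j)) ∧
          a.Passes sys j L n ((L + 1) * r j) (f j m) z (f (!j) (k (!j) (s (!j)))) (fun i b => o i b (!j)))
            = k j (s j) := by
        have hspec := Classical.epsilon_spec (p := fun m => cmp j (cb j m) (s (!j)) ∧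
          a.Passes sys j L n ((L + 1) * r j) (f j m) z (f (!j) (k (!j) (s (!j)))) (fun i b => o i b (!j)))
          ⟨k j (s j), hc1, hb3⟩
        by_contra hne'
        exact hb2 (Or.inr ⟨_, hne', hspec⟩)
      have h3 : (K : ℝ)⁻¹ * ∑ i, sys.dist j (s j i) (g j (s (!j)) (fun i b => o i b (!j)) i) ≤ D j + ε' := by
        rw [inv_mul_le_iff₀ hKpos]
        simp only [hg]
        rw [hdec]
        exact hc2
      have := mul_nonneg hB0 (add_nonneg (ind_nonneg (bads j s)) (ind_nonneg (bad j s o)))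
      linarith
  have hsum : ∑ s, sys.srcBlock K s * ∑ o, W s o *
      ((K : ℝ)⁻¹ * ∑ i, sys.dist j (s j i) (g j (s (!j)) (fun i b => o i b (!j)) i))
      ≤ D j + ε' + B * (∑ s, sys.srcBlock K s * ind (bads j s)
        + ∑ s, sys.srcBlock K s * ∑ o, W s o * ind (bad j s o)) := by
    calc _ ≤ ∑ s, sys.srcBlock K s * ∑ o, W s o * (D j + ε' + B * (ind (bads j s) + ind (bad j s o))) :=
          Finset.sum_le_sum fun s _ => mul_le_mul_of_nonneg_left (Finset.sum_le_sum fun o _ =>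
            mul_le_mul_of_nonneg_left (hpt s o) ((hW s).1 o)) (hP.1 s)
      _ = ∑ s, sys.srcBlock K s * (D j + ε' + B * (ind (bads j s) + ∑ o, W s o * ind (bad j s o))) := by
          refine Finset.sum_congr rfl fun s _ => ?_
          simp only [mul_add, Finset.sum_add_distrib, ← Finset.sum_mul, (hW s).2, one_mul, Finset.mul_sum]
          congr 2
          exact Finset.sum_congr rfl fun o _ => by ring
      _ = _ := by
          simp only [mul_add, Finset.sum_add_distrib, ← Finset.sum_mul, hP.2, one_mul]
          simp only [Finset.mul_sum, add_assoc]
          congr 3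
          · exact Finset.sum_congr rfl fun s _ => by ring
          · exact Finset.sum_congr rfl fun s _ => Finset.sum_congr rfl fun o _ => by ring
  refine hsum.trans ?_
  -- The channel test's false-acceptance bound is matched to the factor exp(-K r) weighting the
  -- compatible words in `hcb`.
  have hexp : ∀ i, Real.exp (-(n * ((L + 1) * r i))) ≤ Real.exp (-(K * r i)) := fun i =>
    Real.exp_le_exp.2 (neg_le_neg (by nlinarith [hr0 i]))
  have hsplit : ∀ i, ∑ s, sys.srcBlock K s * ind (bads i s)
      + Real.exp (-(K * r i)) * ∑ s, sys.srcBlock K s * ∑ m, ind (cmp i (cb i m) (s (!i))) ≤ ε' := by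
    intro i
    refine le_trans (le_of_eq ?_) (hcb i)
    rw [Finset.mul_sum, ← Finset.sum_add_distrib]
    exact Finset.sum_congr rfl fun s _ => by rw [mul_add]; ring
  have hX0 : ∀ i, 0 ≤ ∑ s, sys.srcBlock K s * ind (bads i s) := fun i =>
    Finset.sum_nonneg fun s _ => mul_nonneg (hP.1 s) (ind_nonneg _)
  have hY0 : ∀ i, 0 ≤ ∑ s, sys.srcBlock K s * ∑ m, ind (cmp i (cb i m) (s (!i))) := fun i =>
    Finset.sum_nonneg fun s _ => mul_nonneg (hP.1 s) (Finset.sum_nonneg fun m _ => ind_nonneg _)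
  have hchan : ∑ s, sys.srcBlock K s * ∑ o, W s o * ind (bad j s o) ≤ 4 * ε' := by
    calc _ ≤ ∑ s, sys.srcBlock K s * ∑ o, W s o * ∑ j, ind (bad j s o) :=
          Finset.sum_le_sum fun s _ => mul_le_mul_of_nonneg_left (Finset.sum_le_sum fun o _ =>
            mul_le_mul_of_nonneg_left (Finset.single_le_sum (f := fun j => ind (bad j s o))
              (fun _ _ => ind_nonneg _) (Finset.mem_univ j)) ((hW s).1 o)) (hP.1 s)
      _ ≤ _ := hzf
      _ ≤ ∑ _i : Bool, (ε' + ε') := by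
          refine Finset.sum_le_sum fun i _ => add_le_add (e1 i).le ?_
          exact (mul_le_mul_of_nonneg_right (hexp i) (hY0 i)).trans (by linarith [hsplit i, hX0 i])
      _ = 4 * ε' := by simp; ring
  have hs : ∑ s, sys.srcBlock K s * ind (bads j s) ≤ ε' := by
    have := mul_nonneg (Real.exp_pos (-(K * r j))).le (hY0 j)
    linarith [hsplit j]
  have := mul_le_mul_of_nonneg_left (add_le_add hs hchan) hB0
  linarith

/-- Achievability needs one sequence of codes for all ε; codes within 1/(K + 1) of the infimum work.
-/
lemma exists_seq_of_eventually_exists_le {C : ℕ → Type*} [∀ K, Nonempty (C K)] (d : ∀ K, C K → ℝ)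
    {b : ℝ} (hb : ∀ K c, b ≤ d K c) (h : ∀ ε > 0, ∀ᶠ K in atTop, ∃ c, d K c ≤ ε) :
    ∃ c : ∀ K, C K, ∀ ε > 0, ∀ᶠ K in atTop, d K (c K) ≤ ε := by
  have hc : ∀ K, ∃ c, d K c < (⨅ c, d K c) + 1 / ((K : ℝ) + 1) := fun K =>
    exists_lt_of_ciInf_lt (lt_add_of_pos_right _ (by positivity))
  choose c hc using hc
  refine ⟨c, fun ε hε => ?_⟩
  filter_upwards [h (ε / 2) (half_pos hε),
    tendsto_one_div_add_atTop_nhds_zero_nat.eventually (gt_mem_nhds (half_pos hε))] with K h1 h2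
  obtain ⟨c', hc'⟩ := h1
  have := ciInf_le (f := d K) ⟨b, by rintro _ ⟨c, rfl⟩; exact hb K c⟩ c'
  linarith [hc K]

lemma Code.distortion_nonneg (sys : System S Shat X Y) {N K : ℕ} (c : Code S Shat X Y N K) (j : Bool) :
    0 ≤ c.distortion sys j :=
  Finset.sum_nonneg fun _ _ => Finset.sum_nonneg fun _ _ => mul_nonneg
    (mul_nonneg (Finset.prod_nonneg fun _ _ => sys.src_mem.1 _)
      (Finset.prod_nonneg fun _ _ => (sys.chan_mem _).1 _))
    (mul_nonneg (by positivity) (Finset.sum_nonneg fun _ _ => sys.dist_nonneg j _ _))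

lemma tendsto_div_blocks (L : ℕ) :
    Tendsto (fun K : ℕ => (K : ℝ) / (((K / (L + 1) + 1) * (L + 1) : ℕ) : ℝ)) atTop (𝓝 1) := by
  have hN : ∀ K : ℕ, K ≤ (K / (L + 1) + 1) * (L + 1) ∧ (K / (L + 1) + 1) * (L + 1) ≤ K + (L + 1) := by
    intro K
    have h1 := Nat.div_add_mod K (L + 1)
    have h2 : K % (L + 1) < L + 1 := Nat.mod_lt K (Nat.succ_pos L)
    rw [add_mul, one_mul, mul_comm]
    constructor <;> omega
  refine tendsto_of_tendsto_of_tendsto_of_le_of_le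
    (tendsto_natCast_div_add_atTop ((L : ℝ) + 1)) tendsto_const_nhds (fun K => ?_) fun K => ?_
  · have h1 : (0 : ℝ) < ((K / (L + 1) + 1) * (L + 1) : ℕ) := by positivity
    refine div_le_div_of_nonneg_left (Nat.cast_nonneg K) h1 ?_
    exact (Nat.cast_le.2 (hN K).2).trans (by push_cast; exact le_rfl)
  · exact div_le_one_of_le₀ (Nat.cast_le.2 (hN K).1) (Nat.cast_nonneg _)

lemma System.wzDistortion_nonneg (sys : System S Shat X Y) {j : Bool} {p : S j → T j → ℝ}
    (hp : ∀ s, p s ∈ stdSimplex ℝ (T j)) (h : T j → S (!j) → Shat j) : 0 ≤ sys.wzDistortion j p h :=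
  Finset.sum_nonneg fun _ _ => mul_nonneg ((sys.wzLaw_mem hp).1 _) (sys.dist_nonneg _ _ _)

/-- Wyner-Ziv coding followed by Han's adaptive channel coding achieves rate one. -/
lemma achievable_of_wzInfo_lt_rate {sys : System S Shat X Y} {a : HanScheme V X Y}
    (ha : a.IsStationary sys) {pT : ∀ j, S j → T j → ℝ} (hpT : ∀ j s, pT j s ∈ stdSimplex ℝ (T j))
    (h : ∀ j, T j → S (!j) → Shat j) {D : Bool → ℝ} (hD : ∀ j, sys.wzDistortion j (pT j) (h j) ≤ D j)
    (hlt : ∀ j, sys.wzInfo j (pT j) < a.rate sys j) : sys.Achievable 1 D := by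
  have hD0 : ∀ j, 0 ≤ D j := fun j => (sys.wzDistortion_nonneg (hpT j) (h j)).trans (hD j)
  set r : Bool → ℝ := fun j => (sys.wzInfo j (pT j) + a.rate sys j) / 2 with hrdef
  have hr : ∀ j, sys.wzInfo j (pT j) < r j := fun j => by simp only [hrdef]; linarith [hlt j]
  have hr' : ∀ j, r j < a.rate sys j := fun j => by simp only [hrdef]; linarith [hlt j]
  have hr0 : ∀ j, 0 ≤ r j := fun j => (sys.wzInfo_nonneg (hpT j)).trans (hr j).le
  -- The factor L/(L + 1) lost at block ends is absorbed by the gap between `r` and the rate.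
  obtain ⟨L, hL⟩ : ∃ L : ℕ, ∀ j, (L + 1) * r j < L * a.rate sys j := by
    obtain ⟨L, hL⟩ := exists_nat_gt (∑ j, r j / (a.rate sys j - r j))
    refine ⟨L, fun j => ?_⟩
    have h1 : r j / (a.rate sys j - r j) < L := lt_of_le_of_lt
      (Finset.single_le_sum (f := fun j => r j / (a.rate sys j - r j))
        (fun j _ => div_nonneg (hr0 j) (sub_nonneg.2 (hr' j).le)) (Finset.mem_univ j)) hL
    rw [div_lt_iff₀ (sub_pos.2 (hr' j))] at h1
    linarith
  obtain ⟨s₀, -⟩ := exists_le_of_sum_mul_le (f := fun _ => (0 : ℝ)) (c := 0) sys.src_mem (by simp)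
  obtain ⟨z₀, -⟩ := exists_le_of_sum_mul_le (f := fun _ => (0 : ℝ)) (c := 0) a.init_mem (by simp)
  have ht₀ : ∀ j, Nonempty (T j) := fun j => by
    obtain ⟨t, -⟩ := exists_le_of_sum_mul_le (f := fun _ => (0 : ℝ)) (c := 0) (hpT j (s₀ j)) (by simp)
    exact ⟨t⟩
  obtain ⟨t₀⟩ : Nonempty (∀ j, T j) := Classical.nonempty_pi.2 ht₀
  have hne : ∀ K, Nonempty (Code S Shat X Y ((K / (L + 1) + 1) * (L + 1)) K) := fun K =>
    ⟨⟨fun j _ _ _ => (z₀ j).2.1, fun j _ _ _ => h j (t₀ j) (s₀ (!j))⟩⟩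
  -- The larger of the two excess distortions is minimised, so the same codes serve both terminals.
  obtain ⟨c, hc⟩ := exists_seq_of_eventually_exists_le
    (fun K (c : Code S Shat X Y ((K / (L + 1) + 1) * (L + 1)) K) =>
      max (c.distortion sys false - D false) (c.distortion sys true - D true)) (b := -D false)
    (fun K c => le_max_of_le_left (by linarith [c.distortion_nonneg sys false])) (fun ε hε => by
      filter_upwards [eventually_exists_code ha hpT h hD hD0 hr0 hr L hL hε] with K hK
      obtain ⟨c, hc⟩ := hK
      exact ⟨c, max_le (by linarith [hc false]) (by linarith [hc true])⟩)
  refine ⟨fun K => (K / (L + 1) + 1) * (L + 1), c, fun K => by positivity, tendsto_div_blocks L,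
    fun j => le_of_forall_pos_le_add fun ε hε => ?_⟩
  refine limsup_le_of_le (isCoboundedUnder_le_of_le atTop fun K => (c K).distortion_nonneg sys j) ?_
  filter_upwards [hc ε hε] with K hK
  have h1 := (le_max_left _ _).trans hK
  have h2 := (le_max_right _ _).trans hK
  cases j <;> linarith

end Achievability

end TwoWay

end

theorem corollary2 {S Shat X Y V T : Bool → Type*}
    [∀ j, Fintype (S j)] [∀ j, Fintype (Shat j)] [∀ j, Fintype (X j)] [∀ j, Fintype (Y j)]
    [∀ j, Fintype (V j)] [∀ j, Fintype (T j)]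
    (sys : TwoWay.System S Shat X Y) (D : Bool → ℝ)
    (hD : ∃ c : TwoWay.Configuration S Shat X Y (fun j => V j × T j),
      c ∈ sys.separateConfigurations D ∧
      ∀ j, sys.wzRate j (D j) < (sys.hanRate c j : EReal)) :
    sys.Achievable 1 D := by
  obtain ⟨c, ⟨⟨hstat, -⟩, pV, pT, q, γ, h, hpV, hpT, hq, -, hwz, hPU, hPT, hPW, hF, -⟩, hlt⟩ := hD
  have hc : TwoWay.IsSeparate sys c ⟨pV, hpV, q, hq, γ⟩ pT := ⟨hpT, hPU, hPT, hPW, hF⟩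
  refine TwoWay.achievable_of_wzInfo_lt_rate (hc.isStationary hstat) hpT h (fun j => (hwz j).1) fun j => ?_
  have := hlt j
  -- The Wyner-Ziv function is attained, so the extended-real inequality becomes one between real
  -- informations.
  rw [← (hwz j).2, EReal.coe_lt_coe_iff, hc.hanRate_eq] at this
  exact this
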